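/- Let $(\overline M^{2m+1},\varphi,\xi,\eta,\overline g)$ be a Sasakian space form of constant $\varphi$-sectional curvature $c\in\mathbb R$, that is, a Sasakian manifold (with $\eta=\overline g(\xi,\cdot)$, $\varphi^2=-\mathrm{id}+\eta\otimes\xi$, $d\eta(X,Y)=\overline g(X,\varphi Y)$, $(\overline\nabla_X\varphi)Y=\overline g(X,Y)\xi-\overline g(Y,\xi)X$) whose curvature tensor satisfies $$\begin{aligned}\overline R(X,Y)Z={}&-\tfrac{c-1}{4}\{\eta(Z)[\eta(Y)X-\eta(X)Y]+[\overline g(Y,Z)\eta(X)-\overline g(X,Z)\eta(Y)]\xi\\&+\overline g(\varphi X,Z)\varphi Y+2\overline g(\varphi X,Y)\varphi Z-\overline g(\varphi Y,Z)\varphi X\}+\tfrac{c+3}{4}\{\overline g(Y,Z)X-\overline g(X,Z)Y\}.\end{aligned}$$ Assume that the Ricci tensor $\mathrm{Ric}$ of $\overline g$ is nondegenerate, so that it is a (possibly indefinite) metric on $\overline M$; let $\nabla^\star$ and $R^\star$ be its Levi-Civita connection and curvature. Let $M^{2m}$ be a connected smooth manifold and $\psi:M\to\overline M$ a smooth immersion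 such that $\xi$ is tangent to $M$. Equip $M$ with the metric $g=\psi^*\overline g$, let $N$ be a unit normal ($\overline g(N,N)=1$; it may be chosen separately at each point), $V=-\varphi N$, $A$ the Weingarten operator and $B$ the second fundamental form of $M$ in $(\overline M,\overline g)$, $H=\frac1{2m}\operatorname{trace}_g B$ the mean curvature vector field and $|H|$ its $\overline g$-norm. Call $M$ * *pseudo-Hopf* if $A$ maps $\operatorname{Span}\{\xi,V\}$ into itself at every point; * *Ricci-biharmonic* if $\tau_2^\star(\psi)=-\Delta^\star H-\operatorname{trace}R^\star(d\psi\,\cdot,H)\,d\psi\,\cdot=0$, where $\Delta^\star=-\operatorname{trace}(\nabla^\star)^2$ on sections of $\psi^{-1}T\overline M$, and where the traces (and the Levi-Civita connection of $M$ that enters $(\nabla^\star)^2$) are taken for the metric $\psi^*\mathrm{Ric}$ induced on $M$ by $\mathrm{Ric}$. Suppose that $M$ is a Ricci-biharmonic pseudo-Hopf hypersurface, that $|H|$ is differentiable on $M$, and that $\operatorname{grad}|H|=\beta V$ for some function $\beta:M\to\mathbb R$ (gradient with respect to $g$). Then $\beta=0$ at every point of $M$, and $|H|$ is constant: $M$ has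 constant mean curvature. -/

import Mathlib

open scoped Manifold ContDiff
open Bundle

noncomputable section

namespace RicciBiharmonic

/-! ### Trace of a bilinear map with respect to a nondegenerate symmetric form -/

/-- The trace `∑ g^{ij} B(b_i, b_j)` of a bilinear map `B` with respect to a nondegenerate symmetric
bilinear form `g`: for a basis `b_i` with dual basis `b^i`, the vector `g⁻¹(b^i) = ∑_j g^{ij} b_j`
is the one that represents `b^i` through `g`. For positive definite `g` this is `∑ B(e_i, e_i)`
over any `g`-orthonormal basis. -/
def metricTrace {V W : Type*} [AddCommGroup V] [Module ℝ V] [TopologicalSpace V]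
    [IsTopologicalAddGroup V] [ContinuousSMul ℝ V] [T2Space V] [FiniteDimensional ℝ V]
    [AddCommGroup W] (g : V →L[ℝ] V →L[ℝ] ℝ) (B : V → V → W) : W :=
  ∑ i, B (Module.finBasis ℝ V i)
    (g.inverse (LinearMap.toContinuousLinearMap ((Module.finBasis ℝ V).coord i)))

/-- The pull-back `(v, w) ↦ b(L v, L w)` of a bilinear form under a linear map. -/
def pullForm {V W : Type*} [AddCommGroup V] [Module ℝ V] [TopologicalSpace V]
    [IsTopologicalAddGroup V] [ContinuousSMul ℝ V] [AddCommGroup W] [Module ℝ W]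
    [TopologicalSpace W] [IsTopologicalAddGroup W] [ContinuousSMul ℝ W]
    (b : W →L[ℝ] W →L[ℝ] ℝ) (L : V →L[ℝ] W) : V →L[ℝ] V →L[ℝ] ℝ :=
  (ContinuousLinearMap.precomp ℝ L).comp (b.comp L)

/-! ### Local Riemannian geometry, in an open subset of a Euclidean space

`G` is a field of symmetric nondegenerate bilinear forms, `x` a point, `u v w` vectors. -/

/-- Christoffel symbols of the Levi-Civita connection, by the Koszul formula for constant fields:
`2 G(Γ(u,v), w) = ∂_u G(v,w) + ∂_v G(u,w) - ∂_w G(u,v)`. -/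
def christoffel {n : ℕ}
    (G : EuclideanSpace ℝ (Fin n) →
      EuclideanSpace ℝ (Fin n) →L[ℝ] EuclideanSpace ℝ (Fin n) →L[ℝ] ℝ)
    (x u v : EuclideanSpace ℝ (Fin n)) : EuclideanSpace ℝ (Fin n) :=
  (G x).inverse ((1 / 2 : ℝ) •
    (fderiv ℝ G x u v + fderiv ℝ G x v u - ((fderiv ℝ G x).flip u).flip v))

/-- Curvature `R(u,v)w = ∇_u ∇_v w - ∇_v ∇_u w` for constant fields `u, v, w`. -/
def curvature {n : ℕ}
    (G : EuclideanSpace ℝ (Fin n) →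
      EuclideanSpace ℝ (Fin n) →L[ℝ] EuclideanSpace ℝ (Fin n) →L[ℝ] ℝ)
    (x u v w : EuclideanSpace ℝ (Fin n)) : EuclideanSpace ℝ (Fin n) :=
  fderiv ℝ (fun y ↦ christoffel G y v w) x u - fderiv ℝ (fun y ↦ christoffel G y u w) x v
    + christoffel G x u (christoffel G x v w) - christoffel G x v (christoffel G x u w)

/-- The Ricci tensor `Ric(u,v) = trace (w ↦ R(w,u)v)`, assembled from its components
`Ric(e_i, e_j) = ∑_k (R(e_k,e_i)e_j)_k`. -/
def ricci {n : ℕ}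
    (G : EuclideanSpace ℝ (Fin n) →
      EuclideanSpace ℝ (Fin n) →L[ℝ] EuclideanSpace ℝ (Fin n) →L[ℝ] ℝ)
    (x : EuclideanSpace ℝ (Fin n)) :
    EuclideanSpace ℝ (Fin n) →L[ℝ] EuclideanSpace ℝ (Fin n) →L[ℝ] ℝ :=
  ∑ i, ∑ j, (∑ k, curvature G x (EuclideanSpace.single k 1) (EuclideanSpace.single i 1)
      (EuclideanSpace.single j 1) k) •
    ((EuclideanSpace.proj (𝕜 := ℝ) i).smulRight (EuclideanSpace.proj (𝕜 := ℝ) j) :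
      EuclideanSpace ℝ (Fin n) →L[ℝ] EuclideanSpace ℝ (Fin n) →L[ℝ] ℝ)

/-- The field of forms that `f` induces from `G`: `(f^*G)(u,v) = G(df u, df v)`. -/
def pullbackForm {k n : ℕ}
    (G : EuclideanSpace ℝ (Fin n) →
      EuclideanSpace ℝ (Fin n) →L[ℝ] EuclideanSpace ℝ (Fin n) →L[ℝ] ℝ)
    (f : EuclideanSpace ℝ (Fin k) → EuclideanSpace ℝ (Fin n)) (x : EuclideanSpace ℝ (Fin k)) :
    EuclideanSpace ℝ (Fin k) →L[ℝ] EuclideanSpace ℝ (Fin k) →L[ℝ] ℝ :=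
  pullForm (G (f x)) (fderiv ℝ f x)

/-- The second fundamental form `B = ∇df` of an immersion `f` with the induced metric:
`B(u,v) = ∇_u (df v) - df (∇_u v)`, with the Levi-Civita connections of `G` and of `f^*G`. -/
def localSecondForm {k n : ℕ}
    (G : EuclideanSpace ℝ (Fin n) →
      EuclideanSpace ℝ (Fin n) →L[ℝ] EuclideanSpace ℝ (Fin n) →L[ℝ] ℝ)
    (f : EuclideanSpace ℝ (Fin k) → EuclideanSpace ℝ (Fin n))
    (x u v : EuclideanSpace ℝ (Fin k)) : EuclideanSpace ℝ (Fin n) :=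
  fderiv ℝ (fun y ↦ fderiv ℝ f y v) x u + christoffel G (f x) (fderiv ℝ f x u) (fderiv ℝ f x v)
    - fderiv ℝ f x (christoffel (pullbackForm G f) x u v)

/-- The pull-back along `f` of the Levi-Civita connection of `G`, applied to a field `s`
along `f`, in the direction `u`. -/
def covAlong {k n : ℕ}
    (G : EuclideanSpace ℝ (Fin n) →
      EuclideanSpace ℝ (Fin n) →L[ℝ] EuclideanSpace ℝ (Fin n) →L[ℝ] ℝ)
    (f : EuclideanSpace ℝ (Fin k) → EuclideanSpace ℝ (Fin n))
    (s : EuclideanSpace ℝ (Fin k) → EuclideanSpace ℝ (Fin n))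
    (x u : EuclideanSpace ℝ (Fin k)) : EuclideanSpace ℝ (Fin n) :=
  fderiv ℝ s x u + christoffel G (f x) (fderiv ℝ f x u) (s x)

/-- The Laplacian `Δ s = - trace ∇² s` on fields `s` along `f`, where
`∇²_{u,v} s = ∇_u ∇_v s - ∇_{∇_u v} s` and the trace is taken in the metric `f^*G`. -/
def laplacianAlong {k n : ℕ}
    (G : EuclideanSpace ℝ (Fin n) →
      EuclideanSpace ℝ (Fin n) →L[ℝ] EuclideanSpace ℝ (Fin n) →L[ℝ] ℝ)
    (f : EuclideanSpace ℝ (Fin k) → EuclideanSpace ℝ (Fin n))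
    (s : EuclideanSpace ℝ (Fin k) → EuclideanSpace ℝ (Fin n))
    (x : EuclideanSpace ℝ (Fin k)) : EuclideanSpace ℝ (Fin n) :=
  - metricTrace (pullbackForm G f x) (fun u v ↦
      covAlong G f (fun y ↦ covAlong G f s y v) x u
        - covAlong G f s x (christoffel (pullbackForm G f) x u v))

/-- `- Δ s - trace R(df ·, s) df ·` for a field `s` along `f`, with `Δ`, `R` and the trace formed
with the metric `G` and the metric `f^*G` which it induces. -/
def localBitension {k n : ℕ}
    (G : EuclideanSpace ℝ (Fin n) →
      EuclideanSpace ℝ (Fin n) →L[ℝ] EuclideanSpace ℝ (Fin n) →L[ℝ] ℝ)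
    (f : EuclideanSpace ℝ (Fin k) → EuclideanSpace ℝ (Fin n))
    (s : EuclideanSpace ℝ (Fin k) → EuclideanSpace ℝ (Fin n))
    (x : EuclideanSpace ℝ (Fin k)) : EuclideanSpace ℝ (Fin n) :=
  - laplacianAlong G f s x
    - metricTrace (pullbackForm G f x) (fun u v ↦
        curvature G (f x) (fderiv ℝ f x u) (s x) (fderiv ℝ f x v))

/-! ### Riemannian manifolds and their charts -/

section Charts

variable {n : ℕ} {P : Type*} [TopologicalSpace P] [ChartedSpace (EuclideanSpace ℝ (Fin n)) P]

/-- The components of tangent vectors at `p` in the chart around `q` (`p` in its domain). -/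
def coords (q p : P) : TangentSpace (𝓡 n) p →L[ℝ] EuclideanSpace ℝ (Fin n) :=
  mfderiv (𝓡 n) 𝓘(ℝ, EuclideanSpace ℝ (Fin n)) (extChartAt (𝓡 n) q) p

/-- The tangent vector at `p` with given components in the chart around `q`. -/
def ofCoords (q p : P) : EuclideanSpace ℝ (Fin n) →L[ℝ] TangentSpace (𝓡 n) p :=
  (coords q p).inverse

/-- A Riemannian metric in the chart around `q`. -/
def localMetric [IsManifold (𝓡 n) ∞ P]
    (g : ContMDiffRiemannianMetric (𝓡 n) ∞ (EuclideanSpace ℝ (Fin n))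
      (fun p : P ↦ TangentSpace (𝓡 n) p)) (q : P) (y : EuclideanSpace ℝ (Fin n)) :
    EuclideanSpace ℝ (Fin n) →L[ℝ] EuclideanSpace ℝ (Fin n) →L[ℝ] ℝ :=
  pullForm (g.inner ((extChartAt (𝓡 n) q).symm y))
    (ofCoords q ((extChartAt (𝓡 n) q).symm y))

/-- A field of endomorphisms of the tangent spaces in the chart around `q`. -/
def localEndo (φ : ∀ p : P, TangentSpace (𝓡 n) p →L[ℝ] TangentSpace (𝓡 n) p) (q : P)
    (y : EuclideanSpace ℝ (Fin n)) : EuclideanSpace ℝ (Fin n) →L[ℝ] EuclideanSpace ℝ (Fin n) :=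
  (coords q ((extChartAt (𝓡 n) q).symm y)).comp
    ((φ ((extChartAt (𝓡 n) q).symm y)).comp (ofCoords q ((extChartAt (𝓡 n) q).symm y)))

/-- A vector field in the chart around `q`. -/
def localField (ξ : ∀ p : P, TangentSpace (𝓡 n) p) (q : P) (y : EuclideanSpace ℝ (Fin n)) :
    EuclideanSpace ℝ (Fin n) :=
  coords q ((extChartAt (𝓡 n) q).symm y) (ξ ((extChartAt (𝓡 n) q).symm y))

/-- The Ricci tensor is nondegenerate everywhere, so that it is a (possibly indefinite) metric. -/
def RicciIsMetric [IsManifold (𝓡 n) ∞ P]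
    (g : ContMDiffRiemannianMetric (𝓡 n) ∞ (EuclideanSpace ℝ (Fin n))
      (fun p : P ↦ TangentSpace (𝓡 n) p)) : Prop :=
  ∀ q : P, ∀ y ∈ (extChartAt (𝓡 n) q).target, ∀ u : EuclideanSpace ℝ (Fin n),
    (∀ v, ricci (localMetric g q) y u v = 0) → u = 0

end Charts

/-! ### Sasakian space forms -/

/-- A Sasakian structure `(φ, ξ, η, g)` with `η = g(ξ, ·)` on a manifold of dimension `n`.
The exterior derivative is normalized by `dη(X,Y) = (X η(Y) - Y η(X) - η([X,Y])) / 2`; this and the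
covariant derivative of `φ` are written out in the charts. -/
structure SasakianStructure (n : ℕ) (P : Type*) [TopologicalSpace P]
    [ChartedSpace (EuclideanSpace ℝ (Fin n)) P] [IsManifold (𝓡 n) ∞ P] where
  /-- the Riemannian metric `g` -/
  metric : ContMDiffRiemannianMetric (𝓡 n) ∞ (EuclideanSpace ℝ (Fin n))
    (fun p : P ↦ TangentSpace (𝓡 n) p)
  /-- the endomorphism field `φ` -/
  phi : ∀ p : P, TangentSpace (𝓡 n) p →L[ℝ] TangentSpace (𝓡 n) p
  /-- the structure vector field `ξ` -/
  xi : ∀ p : P, TangentSpace (𝓡 n) p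
  smooth_phi : ContMDiff (𝓡 n)
    ((𝓡 n).prod 𝓘(ℝ, EuclideanSpace ℝ (Fin n) →L[ℝ] EuclideanSpace ℝ (Fin n))) ∞
    (fun p ↦ TotalSpace.mk' (EuclideanSpace ℝ (Fin n) →L[ℝ] EuclideanSpace ℝ (Fin n))
      (E := fun p : P ↦ TangentSpace (𝓡 n) p →L[ℝ] TangentSpace (𝓡 n) p) p (phi p))
  smooth_xi : ContMDiff (𝓡 n) (𝓡 n).tangent ∞
    (fun p ↦ (⟨p, xi p⟩ : TangentBundle (𝓡 n) P))
  phi_phi : ∀ (p : P) (u : TangentSpace (𝓡 n) p),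
    phi p (phi p u) = - u + metric.inner p (xi p) u • xi p
  eta_xi : ∀ p : P, metric.inner p (xi p) (xi p) = 1
  phi_xi : ∀ p : P, phi p (xi p) = 0
  metric_phi : ∀ (p : P) (u v : TangentSpace (𝓡 n) p),
    metric.inner p (phi p u) (phi p v) =
      metric.inner p u v - metric.inner p (xi p) u * metric.inner p (xi p) v
  /-- `dη(X,Y) = g(X, φ Y)` -/
  contact : ∀ q : P, ∀ y ∈ (extChartAt (𝓡 n) q).target, ∀ u v : EuclideanSpace ℝ (Fin n),
    (1 / 2 : ℝ) *
      (fderiv ℝ (fun z ↦ localMetric metric q z (localField xi q z) v) y u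
        - fderiv ℝ (fun z ↦ localMetric metric q z (localField xi q z) u) y v) =
      localMetric metric q y u (localEndo phi q y v)
  /-- `(∇_X φ) Y = g(X,Y) ξ - g(Y,ξ) X` -/
  sasakian : ∀ q : P, ∀ y ∈ (extChartAt (𝓡 n) q).target, ∀ u v : EuclideanSpace ℝ (Fin n),
    fderiv ℝ (fun z ↦ localEndo phi q z v) y u
        + christoffel (localMetric metric q) y u (localEndo phi q y v)
        - localEndo phi q y (christoffel (localMetric metric q) y u v) =
      localMetric metric q y u v • localField xi q y
        - localMetric metric q y v (localField xi q y) • u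

/-- The Sasakian manifold has constant `φ`-sectional curvature `c`: its curvature tensor is
`R(X,Y)Z = -(c-1)/4 {η(Z)[η(Y)X - η(X)Y] + [g(Y,Z)η(X) - g(X,Z)η(Y)]ξ + g(φX,Z)φY + 2g(φX,Y)φZ
- g(φY,Z)φX} + (c+3)/4 {g(Y,Z)X - g(X,Z)Y}`. -/
def SasakianStructure.IsSpaceForm {n : ℕ} {P : Type*} [TopologicalSpace P]
    [ChartedSpace (EuclideanSpace ℝ (Fin n)) P] [IsManifold (𝓡 n) ∞ P]
    (S : SasakianStructure n P) (c : ℝ) : Prop :=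
  ∀ q : P, ∀ y ∈ (extChartAt (𝓡 n) q).target, ∀ X Y Z : EuclideanSpace ℝ (Fin n),
    let g := localMetric S.metric q y
    let φ := localEndo S.phi q y
    let ξ := localField S.xi q y
    curvature (localMetric S.metric q) y X Y Z =
      (-((c - 1) / 4)) • (g ξ Z • (g ξ Y • X - g ξ X • Y)
          + (g Y Z * g ξ X - g X Z * g ξ Y) • ξ
          + g (φ X) Z • φ Y + (2 * g (φ X) Y) • φ Z - g (φ Y) Z • φ X)
        + ((c + 3) / 4) • (g Y Z • X - g X Z • Y)

/-! ### Immersed submanifolds -/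

section Immersions

instance {n : ℕ} {P : Type*} [TopologicalSpace P] [ChartedSpace (EuclideanSpace ℝ (Fin n)) P]
    (p : P) : FiniteDimensional ℝ (TangentSpace (𝓡 n) p) :=
  inferInstanceAs (FiniteDimensional ℝ (EuclideanSpace ℝ (Fin n)))

instance {n : ℕ} {P : Type*} [TopologicalSpace P] [ChartedSpace (EuclideanSpace ℝ (Fin n)) P]
    (p : P) : T2Space (TangentSpace (𝓡 n) p) :=
  inferInstanceAs (T2Space (EuclideanSpace ℝ (Fin n)))

variable {k n : ℕ}
  {M : Type*} [TopologicalSpace M] [ChartedSpace (EuclideanSpace ℝ (Fin k)) M]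
  {P : Type*} [TopologicalSpace P] [ChartedSpace (EuclideanSpace ℝ (Fin n)) P]

/-- A smooth map with injective differential everywhere. -/
def IsSmoothImmersion (ψ : M → P) : Prop :=
  ContMDiff (𝓡 k) (𝓡 n) ∞ ψ ∧
    ∀ p : M, Function.Injective (mfderiv (𝓡 k) (𝓡 n) ψ p)

/-- The map `ψ` in the charts around `p` and `ψ p`. -/
def localMap (ψ : M → P) (p : M) (x : EuclideanSpace ℝ (Fin k)) : EuclideanSpace ℝ (Fin n) :=
  extChartAt (𝓡 n) (ψ p) (ψ ((extChartAt (𝓡 k) p).symm x))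

/-- A vector field along `ψ` in the charts around `p` and `ψ p`. -/
def localAlong (ψ : M → P) (s : ∀ p : M, TangentSpace (𝓡 n) (ψ p)) (p : M)
    (x : EuclideanSpace ℝ (Fin k)) : EuclideanSpace ℝ (Fin n) :=
  coords (ψ p) (ψ ((extChartAt (𝓡 k) p).symm x)) (s ((extChartAt (𝓡 k) p).symm x))

variable [IsManifold (𝓡 n) ∞ P]
  (g : ContMDiffRiemannianMetric (𝓡 n) ∞ (EuclideanSpace ℝ (Fin n))
      (fun p : P ↦ TangentSpace (𝓡 n) p)) (ψ : M → P)

/-- The metric on `M` induced by `g`. -/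
def inducedMetric (p : M) : TangentSpace (𝓡 k) p →L[ℝ] TangentSpace (𝓡 k) p →L[ℝ] ℝ :=
  pullForm (g.inner (ψ p)) (mfderiv (𝓡 k) (𝓡 n) ψ p)

/-- The second fundamental form `B` of `M` in `(P, g)` at `p`. -/
def secondForm (p : M) (u v : TangentSpace (𝓡 k) p) : TangentSpace (𝓡 n) (ψ p) :=
  ofCoords (ψ p) (ψ p) (localSecondForm (localMetric g (ψ p)) (localMap ψ p)
    (extChartAt (𝓡 k) p p) (coords p p u) (coords p p v))

/-- The mean curvature vector field `H = (1 / dim M) trace B` of `M` in `(P, g)`. -/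
def meanCurvatureVector (p : M) : TangentSpace (𝓡 n) (ψ p) :=
  (k : ℝ)⁻¹ • metricTrace (inducedMetric (k := k) g ψ p) (secondForm (k := k) g ψ p)

/-- The mean curvature `|H|`. -/
def meanCurvature (p : M) : ℝ :=
  √(g.inner (ψ p) (meanCurvatureVector (k := k) g ψ p) (meanCurvatureVector (k := k) g ψ p))

/-- The gradient of a function on `M` with respect to the metric induced by `g`. -/
def surfaceGradient (h : M → ℝ) (p : M) : TangentSpace (𝓡 k) p :=
  (inducedMetric g ψ p).inverse
    (mfderiv (𝓡 k) 𝓘(ℝ, ℝ) h p : TangentSpace (𝓡 k) p →L[ℝ] ℝ)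

/-- `N` picks a unit normal vector at each point of `M`. Continuity is not required, so that the
choice exists on every hypersurface, orientable or not. -/
def IsUnitNormal (N : ∀ p : M, TangentSpace (𝓡 n) (ψ p)) : Prop :=
  ∀ p : M, g.inner (ψ p) (N p) (N p) = 1 ∧
    ∀ u : TangentSpace (𝓡 k) p, g.inner (ψ p) (N p) (mfderiv (𝓡 k) (𝓡 n) ψ p u) = 0

/-- The Weingarten operator `A` for the unit normal `N`: the vector `A u` with
`g(A u, v) = g(B(u,v), N)` for all `v`, that is `A u = ∑ g^{ij} g(B(u,b_i),N) b_j`. -/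
def weingarten (N : ∀ p : M, TangentSpace (𝓡 n) (ψ p)) (p : M) (u : TangentSpace (𝓡 k) p) :
    TangentSpace (𝓡 k) p :=
  metricTrace (inducedMetric g ψ p)
    (fun a b ↦ g.inner (ψ p) (secondForm g ψ p u a) (N p) • b)

/-- The bitension field `τ₂* = - Δ* H - trace R*(dψ ·, H) dψ ·`: the connection, the curvature, the
Laplacian and the traces are those of the metric `Ric` on `P` and of the metric it induces on `M`,
and `H` is the mean curvature vector field of `M` in `(P, g)`. -/
def ricciBitension (p : M) : TangentSpace (𝓡 n) (ψ p) :=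
  ofCoords (ψ p) (ψ p) (localBitension (ricci (localMetric g (ψ p))) (localMap (k := k) ψ p)
    (localAlong ψ (meanCurvatureVector (k := k) g ψ) p) (extChartAt (𝓡 k) p p))

/-- `M` is Ricci-biharmonic: its bitension field for the metric `Ric` vanishes. -/
def IsRicciBiharmonic : Prop := ∀ p : M, ricciBitension (k := k) g ψ p = 0

/-- The structure vector field is tangent to `M`. -/
def XiTangent (S : SasakianStructure n P) : Prop :=
  ∀ p : M, ∃ u : TangentSpace (𝓡 k) p, mfderiv (𝓡 k) (𝓡 n) ψ p u = S.xi (ψ p)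

end Immersions

section Hypersurfaces

variable {k n : ℕ}
  {M : Type*} [TopologicalSpace M] [ChartedSpace (EuclideanSpace ℝ (Fin k)) M]
  {P : Type*} [TopologicalSpace P] [ChartedSpace (EuclideanSpace ℝ (Fin n)) P]
  [IsManifold (𝓡 n) ∞ P]

/-- The vector field `V = - φ N`. -/
def fieldV (S : SasakianStructure n P) (ψ : M → P) (N : ∀ p : M, TangentSpace (𝓡 n) (ψ p))
    (p : M) : TangentSpace (𝓡 n) (ψ p) :=
  - S.phi (ψ p) (N p)

/-- Pseudo-Hopf: the Weingarten operator maps `Span {ξ, V}` to itself. -/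
def IsPseudoHopf (S : SasakianStructure n P) (ψ : M → P)
    (N : ∀ p : M, TangentSpace (𝓡 n) (ψ p)) : Prop :=
  ∀ (p : M) (u : TangentSpace (𝓡 k) p),
    mfderiv (𝓡 k) (𝓡 n) ψ p u ∈ Submodule.span ℝ {S.xi (ψ p), fieldV S ψ N p} →
    mfderiv (𝓡 k) (𝓡 n) ψ p (weingarten S.metric ψ N p u) ∈
      Submodule.span ℝ {S.xi (ψ p), fieldV S ψ N p}

end Hypersurfaces

end RicciBiharmonic

end

open RicciBiharmonic

/-! On a Sasakian space form Ric = a g + b η⊗η with constants a, b satisfying a + b = 2m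
(`IsSasakianOn.ricci_eq`). Hence the Levi-Civita connection ∇* of Ric differs from that of g only by
the tensor −(b/a)(η(u)φv + η(v)φu) (`IsSasakianOn.christoffel_deform`), and the whole result comes
from the ξ-component of τ₂* = 0.

Since H is normal and ξ is tangent, η(H) = 0. The curvature term of τ₂* then has no ξ-component,
because η(R*(X,Y)Z) is a multiple of g(Y,Z)η(X) − g(X,Z)η(Y) (`IsSasakianOn.eta_curvature_deform`).
Differentiating η(H) = 0 twice turns the ξ-component of the Laplacian term into −2 times the trace
of T(u,v) = g(dψ u, φ∇*_v H) (`IsSasakianOn.eta_secondDerivative`). So T is trace free.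

Split ∇*_v H = r(v)H + dψ(t v). The operator t is self-adjoint for ψ*Ric, as any shape operator is,
while g(dψ ·, φ dψ ·) is skew; their composition has trace zero (`metricTrace_skew_selfAdjoint`).
What is left of the trace is r(w)/a, where dψ w = φH. Thus r(w) = 0, which says that |H|² is
stationary in the direction φH (`IsSasakianOn.fderiv_normSq_eq_zero`).

At a point with H ≠ 0, φH is a nonzero multiple of V, so grad|H| = βV forces β = 0. At a point with
H = 0 the function |H| is minimal, so its gradient vanishes as well. Connectedness gives constancy.

The computation is done in charts. The second fundamental form is defined in charts centred at the
point under consideration, so its independence of the chart (`localSecondForm_coordChange`) is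
needed before H can be differentiated. -/

namespace RicciBiharmonic

open Filter Topology

set_option maxSynthPendingDepth 3

/-! ### Traces with respect to a possibly indefinite metric. -/

section MetricTrace

variable {V W : Type*} [AddCommGroup V] [Module ℝ V] [TopologicalSpace V]
  [IsTopologicalAddGroup V] [ContinuousSMul ℝ V] [T2Space V] [FiniteDimensional ℝ V]
  [AddCommGroup W] [Module ℝ W]

/-- An injective form on a finite-dimensional space is an isomorphism onto the dual. -/
theorem isInvertible_of_nondegenerate {g : V →L[ℝ] V →L[ℝ] ℝ}
    (h : ∀ u, (∀ v, g u v = 0) → u = 0) : g.IsInvertible := by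
  let e : (V →ₗ[ℝ] ℝ) ≃ₗ[ℝ] (V →L[ℝ] ℝ) := LinearMap.toContinuousLinearMap
  have hfd : FiniteDimensional ℝ (V →L[ℝ] ℝ) := e.finiteDimensional
  have hinj : Function.Injective g.toLinearMap := by
    rw [← LinearMap.ker_eq_bot, LinearMap.ker_eq_bot']
    intro u hu
    exact h u fun v ↦ by
      have := congrArg (fun l : V →L[ℝ] ℝ ↦ l v) hu
      simpa using this
  have hdim : Module.finrank ℝ V = Module.finrank ℝ (V →L[ℝ] ℝ) := by
    rw [← e.finrank_eq]
    exact (Subspace.dual_finrank_eq (K := ℝ) (V := V)).symm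
  refine ⟨(LinearEquiv.ofInjectiveOfFinrankEq g.toLinearMap hinj hdim).toContinuousLinearEquiv, ?_⟩
  ext u v
  rfl

/-- A dual basis of the basis used by `metricTrace`. -/
noncomputable def dualVector (g : V →L[ℝ] V →L[ℝ] ℝ) (i : Fin (Module.finrank ℝ V)) : V :=
  g.inverse (LinearMap.toContinuousLinearMap ((Module.finBasis ℝ V).coord i))

theorem apply_dualVector {g : V →L[ℝ] V →L[ℝ] ℝ} (hg : g.IsInvertible)
    (i : Fin (Module.finrank ℝ V)) (v : V) :
    g (dualVector g i) v = (Module.finBasis ℝ V).coord i v := by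
  rw [dualVector, hg.self_apply_inverse]
  rfl

omit [Module ℝ W] in
theorem metricTrace_def (g : V →L[ℝ] V →L[ℝ] ℝ) (B : V → V → W) :
    metricTrace g B = ∑ i, B (Module.finBasis ℝ V i) (dualVector g i) := rfl

theorem sum_apply_dualVector_smul {g : V →L[ℝ] V →L[ℝ] ℝ} (hg : g.IsInvertible) (v : V) :
    ∑ i, g (dualVector g i) v • Module.finBasis ℝ V i = v := by
  simp_rw [apply_dualVector hg]
  exact (Module.finBasis ℝ V).sum_repr v

theorem sum_apply_basis_smul_dualVector {g : V →L[ℝ] V →L[ℝ] ℝ} (hg : g.IsInvertible) (v : V) :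
    ∑ i, g v (Module.finBasis ℝ V i) • dualVector g i = v := by
  apply hg.injective
  ext w
  conv_rhs => rw [← sum_apply_dualVector_smul hg w]
  simp [mul_comm]

/-- The trace computed in any basis and its dual basis. -/
theorem metricTrace_eq_sum {ι : Type*} [Fintype ι] {g : V →L[ℝ] V →L[ℝ] ℝ}
    (hg : g.IsInvertible) {B : V → V → W} (hB : IsBilinearMap ℝ B) (b c : ι → V)
    (hbc : ∀ v, ∑ i, g v (b i) • c i = v) :
    metricTrace g B = ∑ i, B (b i) (c i) := by
  have h1 : ∀ u v, B u v = hB.toLinearMap u v := fun _ _ ↦ rfl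
  rw [metricTrace_def]
  -- Expanding `b i` in the reference basis produces coefficients that `hbc` reassembles, in the
  -- second slot, into the dual vectors.
  have h2 : ∀ i, B (b i) (c i) = ∑ k, g (dualVector g k) (b i) •
      B (Module.finBasis ℝ V k) (c i) := by
    intro i
    conv_lhs => rw [← sum_apply_dualVector_smul hg (b i)]
    simp [h1]
  simp_rw [h2]
  rw [Finset.sum_comm]
  refine Finset.sum_congr rfl fun k _ ↦ ?_
  conv_lhs => rw [← hbc (dualVector g k)]
  simp [h1]

theorem metricTrace_flip {g : V →L[ℝ] V →L[ℝ] ℝ} (hg : g.IsInvertible)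
    (hs : ∀ u v, g u v = g v u) {B : V → V → W} (hB : IsBilinearMap ℝ B) :
    metricTrace g (fun u v ↦ B v u) = metricTrace g B := by
  rw [metricTrace_eq_sum hg hB (dualVector g) (Module.finBasis ℝ V), metricTrace_def]
  intro v
  simp_rw [hs v]
  exact sum_apply_dualVector_smul hg v

omit [T2Space V] [FiniteDimensional ℝ V] in
theorem pullForm_apply {V' : Type*} [AddCommGroup V'] [Module ℝ V'] [TopologicalSpace V']
    [IsTopologicalAddGroup V'] [ContinuousSMul ℝ V'] (g : V →L[ℝ] V →L[ℝ] ℝ) (L : V' →L[ℝ] V)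
    (u v : V') : pullForm g L u v = g (L u) (L v) := rfl

/-- The trace is invariant under linear isomorphisms. -/
theorem metricTrace_pullForm {V' : Type*} [AddCommGroup V'] [Module ℝ V'] [TopologicalSpace V']
    [IsTopologicalAddGroup V'] [ContinuousSMul ℝ V'] [T2Space V'] [FiniteDimensional ℝ V']
    {g : V →L[ℝ] V →L[ℝ] ℝ} (hg : g.IsInvertible) {g' : V' →L[ℝ] V' →L[ℝ] ℝ}
    (hg' : g'.IsInvertible) {L : V' →L[ℝ] V} (hL : L.IsInvertible)
    (hgg : ∀ u v, g' u v = g (L u) (L v))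
    {B : V → V → W} (hB : IsBilinearMap ℝ B) :
    metricTrace g' (fun u v ↦ B (L u) (L v)) = metricTrace g B := by
  rw [metricTrace_eq_sum hg hB (fun i ↦ L (Module.finBasis ℝ V' i)) (fun i ↦ L (dualVector g' i)),
    metricTrace_def]
  intro v
  obtain ⟨w, rfl⟩ := hL.surjective v
  simp_rw [← hgg, ← map_smul]
  rw [← map_sum, sum_apply_basis_smul_dualVector hg']

theorem map_metricTrace {W' : Type*} [AddCommGroup W'] [Module ℝ W'] (T : W →ₗ[ℝ] W')
    (g : V →L[ℝ] V →L[ℝ] ℝ) (B : V → V → W) :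
    T (metricTrace g B) = metricTrace g (fun u v ↦ T (B u v)) := by
  simp [metricTrace_def]

omit [Module ℝ W] in
theorem metricTrace_add (g : V →L[ℝ] V →L[ℝ] ℝ) (B C : V → V → W) :
    metricTrace g (fun u v ↦ B u v + C u v) = metricTrace g B + metricTrace g C := by
  simp [metricTrace_def, Finset.sum_add_distrib]

omit [Module ℝ W] in
theorem metricTrace_neg (g : V →L[ℝ] V →L[ℝ] ℝ) (B : V → V → W) :
    metricTrace g (fun u v ↦ - B u v) = - metricTrace g B := by
  simp [metricTrace_def]

omit [Module ℝ W] in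
theorem metricTrace_zero (g : V →L[ℝ] V →L[ℝ] ℝ) :
    metricTrace g (fun _ _ ↦ (0 : W)) = 0 := by
  simp [metricTrace_def]

/-- The trace of a rank-one form is an evaluation. This later extracts r(w) from the normal part of
the derivative of H. -/
theorem metricTrace_mul {g : V →L[ℝ] V →L[ℝ] ℝ} (hg : g.IsInvertible)
    (hs : ∀ u v, g u v = g v u) (w : V) (μ : V →ₗ[ℝ] ℝ) :
    metricTrace g (fun u v ↦ g u w * μ v) = μ w := by
  rw [metricTrace_def]
  conv_rhs => rw [← sum_apply_basis_smul_dualVector hg w]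
  simp [hs w]

/-- The trace of the composition of a skew and a self-adjoint endomorphism vanishes. -/
theorem metricTrace_skew_selfAdjoint {g : V →L[ℝ] V →L[ℝ] ℝ} (hg : g.IsInvertible)
    (hs : ∀ u v, g u v = g v u) {C : V → V → ℝ} (hC : IsBilinearMap ℝ C)
    (hskew : ∀ u v, C u v = - C v u) (t : V →ₗ[ℝ] V) (ht : ∀ u v, g (t u) v = g u (t v)) :
    metricTrace g (fun u v ↦ C u (t v)) = 0 := by
  have h1 : ∀ u v, C u v = hC.toLinearMap u v := fun _ _ ↦ rfl
  have hB : IsBilinearMap ℝ (fun u v ↦ C u (t v)) :=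
    ⟨by simp [h1], by simp [h1], by simp [h1], by simp [h1]⟩
  -- Self-adjointness moves `t` to the other slot: both sides are double sums with coefficients g(t
  -- bⁱ, b_j), where bⁱ is the dual basis.
  have h2 : metricTrace g (fun u v ↦ C u (t v)) = metricTrace g (fun u v ↦ C (t u) v) := by
    rw [metricTrace_def, metricTrace_def]
    have h3 : ∀ i, C (Module.finBasis ℝ V i) (t (dualVector g i)) =
        ∑ j, g (t (dualVector g i)) (Module.finBasis ℝ V j) *
          C (Module.finBasis ℝ V i) (dualVector g j) := by
      intro i
      conv_lhs => rw [← sum_apply_basis_smul_dualVector hg (t (dualVector g i))]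
      simp [h1]
    simp_rw [h3]
    rw [Finset.sum_comm]
    refine Finset.sum_congr rfl fun j _ ↦ ?_
    conv_rhs => rw [← sum_apply_dualVector_smul hg (t (Module.finBasis ℝ V j))]
    simp [h1, ht]
  -- Skewness and the symmetry of the trace move it back with the opposite sign, so the trace equals
  -- its own negative.
  have h4 : metricTrace g (fun u v ↦ C (t u) v) = - metricTrace g (fun u v ↦ C u (t v)) := by
    rw [← metricTrace_flip hg hs hB, ← metricTrace_neg]
    congr 1
    ext u v
    rw [hskew]
  linarith

end MetricTrace

/-! ### The Levi-Civita connection on an open set. -/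

/-- The model space of the charts. -/
abbrev Euc (n : ℕ) := EuclideanSpace ℝ (Fin n)

/-- Fields of bilinear forms in a chart. -/
abbrev FormField (n : ℕ) := Euc n → Euc n →L[ℝ] Euc n →L[ℝ] ℝ

/-- A smooth pseudo-Riemannian metric on an open set. -/
structure IsMetricOn {n : ℕ} (G : FormField n) (U : Set (Euc n)) : Prop where
  isOpen : IsOpen U
  contDiffOn : ContDiffOn ℝ ∞ G U
  symm : ∀ y ∈ U, ∀ u v, G y u v = G y v u
  isInvertible : ∀ y ∈ U, (G y).IsInvertible

section LeviCivita

variable {k n : ℕ} {G : FormField n} {U : Set (Euc n)}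

namespace IsMetricOn

variable (hG : IsMetricOn G U) {y : Euc n} (hy : y ∈ U)
include hG hy

theorem contDiffAt : ContDiffAt ℝ ∞ G y :=
  (hG.contDiffOn y hy).contDiffAt (hG.isOpen.mem_nhds hy)

theorem differentiableAt : DifferentiableAt ℝ G y :=
  (hG.contDiffAt hy).differentiableAt (by simp)

theorem fderiv_apply (u v w : Euc n) :
    fderiv ℝ G y u v w = fderiv ℝ (fun z ↦ G z v w) y u := by
  have h1 := (hG.differentiableAt hy).hasFDerivAt.clm_apply (hasFDerivAt_const v y)
  have h2 := h1.clm_apply (hasFDerivAt_const w y)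
  rw [h2.fderiv]
  simp

theorem fderiv_symm (u v w : Euc n) : fderiv ℝ G y u v w = fderiv ℝ G y u w v := by
  rw [hG.fderiv_apply hy, hG.fderiv_apply hy]
  congr 1
  apply Filter.EventuallyEq.fderiv_eq
  filter_upwards [hG.isOpen.mem_nhds hy] with z hz
  exact hG.symm z hz v w

theorem apply_christoffel (u v w : Euc n) :
    2 * G y (christoffel G y u v) w =
      fderiv ℝ G y u v w + fderiv ℝ G y v u w - fderiv ℝ G y w u v := by
  rw [christoffel, (hG.isInvertible y hy).self_apply_inverse]
  simp

/-- Uniqueness in the Koszul formula, by nondegeneracy. Connections are identified through it, both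
for the absence of torsion and for the deformed metric. -/
theorem eq_christoffel {u v W : Euc n} (h : ∀ w, 2 * G y W w =
    fderiv ℝ G y u v w + fderiv ℝ G y v u w - fderiv ℝ G y w u v) :
    W = christoffel G y u v := by
  apply (hG.isInvertible y hy).injective
  ext w
  have := hG.apply_christoffel hy u v w
  linarith [h w]

theorem christoffel_symm (u v : Euc n) : christoffel G y u v = christoffel G y v u := by
  apply hG.eq_christoffel hy
  intro w
  rw [hG.apply_christoffel hy, hG.fderiv_symm hy w]
  ring

theorem fderiv_eq_christoffel (u v w : Euc n) : fderiv ℝ G y u v w =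
    G y (christoffel G y u v) w + G y v (christoffel G y u w) := by
  have h1 := hG.apply_christoffel hy u v w
  have h2 := hG.apply_christoffel hy u w v
  rw [hG.symm y hy v]
  have h3 := hG.fderiv_symm hy u v w
  have h4 := hG.fderiv_symm hy v u w
  have h5 := hG.fderiv_symm hy w u v
  linarith

end IsMetricOn

theorem isBilinearMap_christoffel (G : FormField n) (y : Euc n) :
    IsBilinearMap ℝ (christoffel G y) where
  add_left a b c := by
    simp only [christoffel, ← map_add]; congr 1; ext w; simp; ring
  smul_left a b c := by
    simp only [christoffel, ← map_smul]; congr 1; ext w; simp; ring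
  add_right a b c := by
    simp only [christoffel, ← map_add]; congr 1; ext w; simp; ring
  smul_right a b c := by
    simp only [christoffel, ← map_smul]; congr 1; ext w; simp; ring

/-- Smoothness of the Levi-Civita connection applied to smooth data. -/
theorem IsMetricOn.contDiffAt_christoffel {F : Type*} [NormedAddCommGroup F] [NormedSpace ℝ F]
    (hG : IsMetricOn G U) {f u v : F → Euc n} {x : F} (hx : f x ∈ U) (hf : ContDiffAt ℝ ∞ f x)
    (hu : ContDiffAt ℝ ∞ u x) (hv : ContDiffAt ℝ ∞ v x) :
    ContDiffAt ℝ ∞ (fun z ↦ christoffel G (f z) (u z) (v z)) x := by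
  have h1 : ContDiffAt ℝ ∞ (fun z ↦ G (f z)) x := (hG.contDiffAt hx).comp x hf
  have h2 : ContDiffAt ℝ ∞ (fun z ↦ fderiv ℝ G (f z)) x :=
    ((hG.contDiffAt hx).fderiv_right (by simp)).comp x hf
  have h3 : ContDiffAt ℝ ∞ (fun z ↦ (G (f z)).inverse) x := by
    have := (hG.isInvertible _ hx).contDiffAt_map_inverse (n := ∞)
    exact this.comp x h1
  have h4 : ContDiffAt ℝ ∞ (fun z ↦ fderiv ℝ G (f z) (u z) (v z)) x :=
    (h2.clm_apply hu).clm_apply hv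
  have h5 : ContDiffAt ℝ ∞ (fun z ↦ fderiv ℝ G (f z) (v z) (u z)) x :=
    (h2.clm_apply hv).clm_apply hu
  have h6 : ContDiffAt ℝ ∞ (fun z ↦ ((fderiv ℝ G (f z)).flip (u z)).flip (v z)) x := by
    have e1 : ContDiffAt ℝ ∞ (fun z ↦ (fderiv ℝ G (f z)).flip) x :=
      (ContinuousLinearMap.flipₗᵢ ℝ (Euc n) (Euc n)
        (Euc n →L[ℝ] ℝ)).toContinuousLinearEquiv.contDiff.contDiffAt.comp x h2
    have e2 : ContDiffAt ℝ ∞ (fun z ↦ ((fderiv ℝ G (f z)).flip (u z)).flip) x :=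
      (ContinuousLinearMap.flipₗᵢ ℝ (Euc n) (Euc n) ℝ).toContinuousLinearEquiv.contDiff.contDiffAt.comp
        x (e1.clm_apply hu)
    exact e2.clm_apply hv
  exact h3.clm_apply (((h4.add h5).sub h6).const_smul (1 / 2 : ℝ))

/-- Metric compatibility of the pulled back connection. -/
theorem IsMetricOn.fderiv_apply_along {F : Type*} [NormedAddCommGroup F] [NormedSpace ℝ F]
    (hG : IsMetricOn G U) {f s t : F → Euc n} {x : F} (hx : f x ∈ U)
    (hf : DifferentiableAt ℝ f x) (hs : DifferentiableAt ℝ s x) (ht : DifferentiableAt ℝ t x)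
    (u : F) :
    fderiv ℝ (fun z ↦ G (f z) (s z) (t z)) x u =
      G (f x) (fderiv ℝ s x u + christoffel G (f x) (fderiv ℝ f x u) (s x)) (t x) +
      G (f x) (s x) (fderiv ℝ t x u + christoffel G (f x) (fderiv ℝ f x u) (t x)) := by
  have h1 := ((hG.differentiableAt hx).hasFDerivAt.comp x hf.hasFDerivAt).clm_apply hs.hasFDerivAt
  have h2 := h1.clm_apply ht.hasFDerivAt
  have h3 := h2.fderiv
  simp only [Function.comp_apply] at h3
  rw [h3]
  have h4 := hG.fderiv_eq_christoffel hx (fderiv ℝ f x u) (s x) (t x)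
  simp [h4]
  ring

end LeviCivita

/-! ### The second fundamental form and its independence of charts. -/

section Immersion

theorem christoffel_congr {n : ℕ} {G G' : FormField n} {y : Euc n} (h : G =ᶠ[𝓝 y] G') :
    christoffel G y = christoffel G' y := by
  ext1 u
  ext1 v
  rw [christoffel, christoffel, h.fderiv_eq, h.eq_of_nhds]

theorem pullbackForm_congr {k n : ℕ} {G : FormField n} {f f' : Euc k → Euc n} {x : Euc k}
    (h : f =ᶠ[𝓝 x] f') :
    pullbackForm G f =ᶠ[𝓝 x] pullbackForm G f' := by
  filter_upwards [h, h.fderiv (𝕜 := ℝ)] with y hy hy'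
  rw [pullbackForm, pullbackForm, hy, hy']

theorem localSecondForm_congr {k n : ℕ} {G : FormField n} {f f' : Euc k → Euc n} {x : Euc k}
    (h : f =ᶠ[𝓝 x] f') : localSecondForm G f x = localSecondForm G f' x := by
  have h1 : fderiv ℝ f =ᶠ[𝓝 x] fderiv ℝ f' := h.fderiv
  have h2 : pullbackForm G f =ᶠ[𝓝 x] pullbackForm G f' := pullbackForm_congr h
  ext1 u
  ext1 v
  have h3 : (fun y ↦ fderiv ℝ f y v) =ᶠ[𝓝 x] fun y ↦ fderiv ℝ f' y v := by
    filter_upwards [h1] with y hy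
    rw [hy]
  rw [localSecondForm, localSecondForm, h.eq_of_nhds, h1.eq_of_nhds, christoffel_congr h2,
    h3.fderiv_eq]

variable {k n : ℕ} {G : FormField n} {U : Set (Euc n)} {f : Euc k → Euc n} {O : Set (Euc k)}
  {x : Euc k}

section SecondDerivative

variable {E F : Type*} [NormedAddCommGroup E] [NormedSpace ℝ E] [NormedAddCommGroup F]
  [NormedSpace ℝ F] {f : E → F} {x : E}

theorem contDiffAt_fderiv_apply (hf : ContDiffAt ℝ ∞ f x) (v : E) :
    ContDiffAt ℝ ∞ (fun y ↦ fderiv ℝ f y v) x :=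
  (hf.fderiv_right (by simp)).clm_apply contDiffAt_const

theorem fderiv_fderiv_apply (hf : ContDiffAt ℝ ∞ f x) (u v : E) :
    fderiv ℝ (fun y ↦ fderiv ℝ f y v) x u = fderiv ℝ (fderiv ℝ f) x u v := by
  have h1 : DifferentiableAt ℝ (fderiv ℝ f) x :=
    (hf.fderiv_right (m := ∞) (by simp)).differentiableAt (by simp)
  have h2 := h1.hasFDerivAt.clm_apply (hasFDerivAt_const v x)
  rw [h2.fderiv]
  simp

theorem two_le_smooth : (2 : WithTop ℕ∞) ≤ ∞ :=
  WithTop.coe_le_coe.2 (le_top : (2 : ℕ∞) ≤ ⊤)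

theorem fderiv_fderiv_symm (hf : ContDiffAt ℝ ∞ f x) (u v : E) :
    fderiv ℝ (fun y ↦ fderiv ℝ f y v) x u = fderiv ℝ (fun y ↦ fderiv ℝ f y u) x v := by
  rw [fderiv_fderiv_apply hf, fderiv_fderiv_apply hf]
  exact (hf.isSymmSndFDerivAt (by simpa using two_le_smooth)) u v

end SecondDerivative

/-- A nondegenerate induced form is a metric. -/
theorem IsMetricOn.pullbackForm (hG : IsMetricOn G U) (hO : IsOpen O) (hf : ContDiffOn ℝ ∞ f O)
    (hU : Set.MapsTo f O U)
    (hnd : ∀ x ∈ O, ∀ u, (∀ v, G (f x) (fderiv ℝ f x u) (fderiv ℝ f x v) = 0) → u = 0) :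
    IsMetricOn (RicciBiharmonic.pullbackForm G f) O where
  isOpen := hO
  contDiffOn := by
    refine contDiffOn_clm_apply.2 fun u ↦ contDiffOn_clm_apply.2 fun v x hx ↦ ?_
    have h1 : ContDiffAt ℝ ∞ f x := hf.contDiffAt (hO.mem_nhds hx)
    have h2 : ContDiffAt ℝ ∞ (fun y ↦ G (f y)) x := (hG.contDiffAt (hU hx)).comp x h1
    exact ((h2.clm_apply (contDiffAt_fderiv_apply h1 u)).clm_apply
      (contDiffAt_fderiv_apply h1 v)).contDiffWithinAt
  symm y hy u v := hG.symm _ (hU hy) _ _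
  isInvertible y hy := isInvertible_of_nondegenerate (hnd y hy)

theorem isBilinearMap_localSecondForm (G : FormField n) (hf : ContDiffAt ℝ ∞ f x) :
    IsBilinearMap ℝ (localSecondForm G f x) := by
  have h1 := isBilinearMap_christoffel G (f x)
  have h2 := isBilinearMap_christoffel (RicciBiharmonic.pullbackForm G f) x
  constructor
  all_goals
    intros
    simp only [localSecondForm, fderiv_fderiv_apply hf]
    simp only [map_add, map_smul, h1.add_left,
      h1.smul_left, h2.add_left, h2.smul_left, h1.add_right, h1.smul_right, h2.add_right,
      h2.smul_right, add_apply, smul_apply]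
    module

/-- The second fundamental form takes values in the normal space. -/
theorem apply_localSecondForm (hG : IsMetricOn G U) (hM : IsMetricOn (pullbackForm G f) O)
    (hx : x ∈ O) (hfx : f x ∈ U) (hf : ContDiffAt ℝ ∞ f x) (u v w : Euc k) :
    G (f x) (localSecondForm G f x u v) (fderiv ℝ f x w) = 0 := by
  have hd := hf.differentiableAt (by simp)
  have hd' : ∀ v, DifferentiableAt ℝ (fun y ↦ fderiv ℝ f y v) x := fun v ↦
    (contDiffAt_fderiv_apply hf v).differentiableAt (by simp)
  -- Ambient metric compatibility along `f` expresses the derivatives of the induced metric through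
  -- ∇(df). In the Koszul formula the symmetry of D²f and of Γ then cancels all but 2G(∇_u(df v), df
  -- w).
  have key : ∀ u v w, fderiv ℝ (pullbackForm G f) x u v w = _ := fun u v w ↦
    (hM.fderiv_apply hx u v w).trans (hG.fderiv_apply_along hfx hd (hd' v) (hd' w) u)
  have h1 := hM.apply_christoffel hx u v w
  have h2 : pullbackForm G f x (christoffel (pullbackForm G f) x u v) w =
    G (f x) (fderiv ℝ f x (christoffel (pullbackForm G f) x u v)) (fderiv ℝ f x w) := rfl
  rw [h2, key, key, key] at h1
  rw [localSecondForm, map_sub, sub_apply]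
  have s1 := fderiv_fderiv_symm hf u v
  have s2 := fderiv_fderiv_symm hf u w
  have s3 := fderiv_fderiv_symm hf v w
  have c1 := hG.christoffel_symm hfx (fderiv ℝ f x u) (fderiv ℝ f x v)
  have c2 := hG.christoffel_symm hfx (fderiv ℝ f x u) (fderiv ℝ f x w)
  have c3 := hG.christoffel_symm hfx (fderiv ℝ f x v) (fderiv ℝ f x w)
  rw [← s1, ← s2, ← s3, ← c1, ← c2, ← c3] at h1
  have m1 := hG.symm _ hfx (fderiv ℝ f x v)
    (fderiv ℝ (fun y ↦ fderiv ℝ f y w) x u + christoffel G (f x) (fderiv ℝ f x u) (fderiv ℝ f x w))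
  have m2 := hG.symm _ hfx (fderiv ℝ f x u)
    (fderiv ℝ (fun y ↦ fderiv ℝ f y w) x v + christoffel G (f x) (fderiv ℝ f x v) (fderiv ℝ f x w))
  linarith

/-- The second fundamental form of a local diffeomorphism vanishes. -/
theorem localSecondForm_eq_zero {κ : Euc n → Euc n} {O : Set (Euc n)} {x : Euc n}
    (hG : IsMetricOn G U) (hM : IsMetricOn (pullbackForm G κ) O)
    (hx : x ∈ O) (hfx : κ x ∈ U) (hf : ContDiffAt ℝ ∞ κ x) (hi : (fderiv ℝ κ x).IsInvertible)
    (u v : Euc n) : localSecondForm G κ x u v = 0 := by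
  -- The form takes normal values, and every vector is tangent since dκ is onto.
  apply (hG.isInvertible _ hfx).injective
  ext w
  obtain ⟨w, rfl⟩ := hi.surjective w
  rw [apply_localSecondForm hG hM hx hfx hf]
  simp

theorem fderiv_comp_eventuallyEq {l : ℕ} {κ : Euc n → Euc l} (hf : ContDiffAt ℝ ∞ f x)
    (hκ : ContDiffAt ℝ ∞ κ (f x)) :
    ∀ᶠ y in 𝓝 x, fderiv ℝ (κ ∘ f) y = (fderiv ℝ κ (f y)).comp (fderiv ℝ f y) := by
  have h1 : ∀ᶠ y in 𝓝 x, ContDiffAt ℝ 1 f y :=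
    (hf.of_le (by simp)).eventually (by simp)
  have h2 : ∀ᶠ y in 𝓝 (f x), ContDiffAt ℝ 1 κ y :=
    (hκ.of_le (by simp)).eventually (by simp)
  filter_upwards [h1, hf.continuousAt.eventually h2] with y h1 h2
  exact fderiv_comp y (h2.differentiableAt (by simp)) (h1.differentiableAt (by simp))

theorem pullbackForm_comp_eventuallyEq {l : ℕ} {G' : FormField l} {κ : Euc n → Euc l}
    (hκG : pullbackForm G' κ =ᶠ[𝓝 (f x)] G) (hf : ContDiffAt ℝ ∞ f x)
    (hκ : ContDiffAt ℝ ∞ κ (f x)) :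
    pullbackForm G' (κ ∘ f) =ᶠ[𝓝 x] pullbackForm G f := by
  filter_upwards [fderiv_comp_eventuallyEq hf hκ, hf.continuousAt.eventually hκG] with y h1 h2
  ext a b
  have h3 := congrArg (fun g ↦ g (fderiv ℝ f y a) (fderiv ℝ f y b)) h2
  simp only [pullbackForm, pullForm_apply] at h3 ⊢
  rw [h1]
  exact h3

/-- Pull-backs under coordinate changes agree with the given metric only near a point, so the domain
has to shrink. -/
theorem IsMetricOn.exists_of_eventuallyEq {G' : FormField n} (hG : IsMetricOn G U) {y : Euc n}
    (hy : y ∈ U) (h : G' =ᶠ[𝓝 y] G) : ∃ U', y ∈ U' ∧ IsMetricOn G' U' := by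
  have heq : ∀ z ∈ interior {z | G' z = G z} ∩ U, G' z = G z := fun z hz ↦ by
    have := interior_subset hz.1
    exact this
  refine ⟨interior {z | G' z = G z} ∩ U, ⟨mem_interior_iff_mem_nhds.2 h, hy⟩,
    isOpen_interior.inter hG.isOpen,
    (hG.contDiffOn.mono Set.inter_subset_right).congr heq, fun z hz ↦ ?_, fun z hz ↦ ?_⟩
  · rw [heq z hz]
    exact hG.symm z hz.2
  · rw [heq z hz]
    exact hG.isInvertible z hz.2

/-- The second fundamental form of a composition. -/
theorem localSecondForm_comp {l : ℕ} {G' : FormField l} {κ : Euc n → Euc l}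
    (hκG : pullbackForm G' κ =ᶠ[𝓝 (f x)] G) (hf : ContDiffAt ℝ ∞ f x)
    (hκ : ContDiffAt ℝ ∞ κ (f x)) (u v : Euc k) :
    localSecondForm G' (κ ∘ f) x u v =
      localSecondForm G' κ (f x) (fderiv ℝ f x u) (fderiv ℝ f x v) +
        fderiv ℝ κ (f x) (localSecondForm G f x u v) := by
  have hfd := fderiv_comp_eventuallyEq hf hκ
  have hM := pullbackForm_comp_eventuallyEq hκG hf hκ
  have hD : fderiv ℝ (fun y ↦ fderiv ℝ (κ ∘ f) y v) x u =
      fderiv ℝ (fderiv ℝ κ) (f x) (fderiv ℝ f x u) (fderiv ℝ f x v) +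
        fderiv ℝ κ (f x) (fderiv ℝ (fun y ↦ fderiv ℝ f y v) x u) := by
    have e1 : (fun y ↦ fderiv ℝ (κ ∘ f) y v) =ᶠ[𝓝 x]
        fun y ↦ fderiv ℝ κ (f y) (fderiv ℝ f y v) := by
      filter_upwards [hfd] with y hy
      rw [hy]
      rfl
    rw [e1.fderiv_eq]
    have e2 : HasFDerivAt (fun y ↦ fderiv ℝ κ (f y)) _ x :=
      (((hκ.fderiv_right (m := ∞) (by simp)).differentiableAt (by simp)).hasFDerivAt).comp x
        (hf.differentiableAt (by simp)).hasFDerivAt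
    rw [(e2.clm_apply
      ((contDiffAt_fderiv_apply hf v).differentiableAt (by simp)).hasFDerivAt).fderiv]
    simp [add_comm]
  simp only [localSecondForm]
  rw [hD, christoffel_congr hM, christoffel_congr hκG, hfd.self_of_nhds,
    fderiv_fderiv_apply hκ]
  simp only [ContinuousLinearMap.comp_apply, map_sub, map_add, Function.comp_apply]
  abel

/-- The second fundamental form does not depend on the charts. -/
theorem localSecondForm_coordChange {G' : FormField n} {U' : Set (Euc n)} {f' : Euc k → Euc n}
    {O' : Set (Euc k)} {χ : Euc k → Euc k} {κ : Euc n → Euc n}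
    (hG : IsMetricOn G U) (hM : IsMetricOn (pullbackForm G f) O) (hx : x ∈ O)
    (hG' : IsMetricOn G' U') (hM' : IsMetricOn (pullbackForm G' f') O')
    (hfx : f x ∈ U) (hfx' : κ (f x) ∈ U') (hx' : χ x ∈ O')
    (hf : ContDiffAt ℝ ∞ f x) (hf' : ContDiffAt ℝ ∞ f' (χ x)) (hχ : ContDiffAt ℝ ∞ χ x)
    (hκ : ContDiffAt ℝ ∞ κ (f x)) (hχi : (fderiv ℝ χ x).IsInvertible)
    (hκi : (fderiv ℝ κ (f x)).IsInvertible) (hκG : pullbackForm G' κ =ᶠ[𝓝 (f x)] G)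
    (hcomm : f' ∘ χ =ᶠ[𝓝 x] κ ∘ f) (u v : Euc k) :
    localSecondForm G' f' (χ x) (fderiv ℝ χ x u) (fderiv ℝ χ x v) =
      fderiv ℝ κ (f x) (localSecondForm G f x u v) := by
  -- Both κ and χ are local isometries, so their own second fundamental forms vanish. The
  -- composition formula for κ ∘ f and for f' ∘ χ, which agree near x, then computes one form in two
  -- ways.
  obtain ⟨U₁, hU₁, hκM⟩ := hG.exists_of_eventuallyEq hfx hκG
  have h2 : pullbackForm (pullbackForm G' f') χ =ᶠ[𝓝 x] pullbackForm G f :=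
    ((pullbackForm_comp_eventuallyEq EventuallyEq.rfl hχ hf').symm.trans
      (pullbackForm_congr hcomm)).trans (pullbackForm_comp_eventuallyEq hκG hf hκ)
  obtain ⟨O₁, hO₁, hχM⟩ := hM.exists_of_eventuallyEq hx h2
  have h1 := localSecondForm_comp hκG hf hκ u v
  rw [localSecondForm_eq_zero hG' hκM hU₁ hfx' hκ hκi, zero_add, ← localSecondForm_congr hcomm,
    localSecondForm_comp EventuallyEq.rfl hχ hf', localSecondForm_eq_zero hM' hχM hO₁ hx' hχ hχi,
    map_zero, add_zero] at h1
  exact h1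

/-- The mean curvature vector field is smooth. -/
theorem contDiffOn_metricTrace_localSecondForm (hG : IsMetricOn G U)
    (hM : IsMetricOn (pullbackForm G f) O) (hf : ContDiffOn ℝ ∞ f O) (hU : Set.MapsTo f O U) :
    ContDiffOn ℝ ∞ (fun x ↦ metricTrace (pullbackForm G f x) (localSecondForm G f x)) O := by
  intro x hx
  refine ContDiffAt.contDiffWithinAt ?_
  have hat : ∀ y ∈ O, ContDiffAt ℝ ∞ f y := fun y hy ↦ hf.contDiffAt (hM.isOpen.mem_nhds hy)
  simp only [metricTrace_def]
  refine ContDiffAt.sum fun i _ ↦ ?_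
  set u := Module.finBasis ℝ (Euc k) i
  have hv : ContDiffAt ℝ ∞ (fun y ↦ dualVector (pullbackForm G f y) i) x := by
    have h1 : ContDiffAt ℝ ∞ (fun y ↦ (pullbackForm G f y).inverse) x :=
      ((hM.isInvertible x hx).contDiffAt_map_inverse (n := ∞)).comp x (hM.contDiffAt hx)
    exact h1.clm_apply contDiffAt_const
  -- In `localSecondForm` the second argument is frozen while it is differentiated, whereas the dual
  -- vector moves with y. Writing the term as D²f(y) applied to the two vectors makes the dependence
  -- on y manifestly smooth.
  have h2 : (fun y ↦ localSecondForm G f y u (dualVector (pullbackForm G f y) i)) =ᶠ[𝓝 x]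
      fun y ↦ fderiv ℝ (fderiv ℝ f) y u (dualVector (pullbackForm G f y) i) +
        christoffel G (f y) (fderiv ℝ f y u) (fderiv ℝ f y (dualVector (pullbackForm G f y) i)) -
        fderiv ℝ f y (christoffel (pullbackForm G f) y u (dualVector (pullbackForm G f y) i)) := by
    filter_upwards [hM.isOpen.mem_nhds hx] with y hy
    rw [localSecondForm, fderiv_fderiv_apply (hat y hy)]
  refine ContDiffAt.congr_of_eventuallyEq ?_ h2
  have h3 : ContDiffAt ℝ ∞ (fderiv ℝ f) x := (hat x hx).fderiv_right (by simp)
  have h4 : ContDiffAt ℝ ∞ (fderiv ℝ (fderiv ℝ f)) x := h3.fderiv_right (by simp)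
  exact (((h4.clm_apply contDiffAt_const).clm_apply hv).add
    (hG.contDiffAt_christoffel (hU hx) (hat x hx) (contDiffAt_fderiv_apply (hat x hx) u)
      (h3.clm_apply hv))).sub
    (h3.clm_apply (hM.contDiffAt_christoffel (f := id) hx contDiffAt_id contDiffAt_const hv))

end Immersion

/-! ### Sasakian identities in a chart. -/

/-- A Sasakian structure on an open subset of a Euclidean space. -/
structure IsSasakianOn {n : ℕ} (G : FormField n) (φ : Euc n → Euc n →L[ℝ] Euc n)
    (ξ : Euc n → Euc n) (U : Set (Euc n)) : Prop where
  metric : IsMetricOn G U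
  pos : ∀ y ∈ U, ∀ u, u ≠ 0 → 0 < G y u u
  smooth_phi : ContDiffOn ℝ ∞ φ U
  smooth_xi : ContDiffOn ℝ ∞ ξ U
  phi_phi : ∀ y ∈ U, ∀ u, φ y (φ y u) = - u + G y (ξ y) u • ξ y
  eta_xi : ∀ y ∈ U, G y (ξ y) (ξ y) = 1
  phi_xi : ∀ y ∈ U, φ y (ξ y) = 0
  metric_phi : ∀ y ∈ U, ∀ u v, G y (φ y u) (φ y v) = G y u v - G y (ξ y) u * G y (ξ y) v
  sasakian : ∀ y ∈ U, ∀ u v, fderiv ℝ (fun z ↦ φ z v) y u + christoffel G y u (φ y v)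
    - φ y (christoffel G y u v) = G y u v • ξ y - G y v (ξ y) • u

namespace IsSasakianOn

variable {n : ℕ} {G : FormField n} {φ : Euc n → Euc n →L[ℝ] Euc n} {ξ : Euc n → Euc n}
  {U : Set (Euc n)} (hS : IsSasakianOn G φ ξ U) {y : Euc n} (hy : y ∈ U)
include hS hy

theorem symm (u v : Euc n) : G y u v = G y v u := hS.metric.symm y hy u v

theorem contDiffAt_phi : ContDiffAt ℝ ∞ φ y :=
  hS.smooth_phi.contDiffAt (hS.metric.isOpen.mem_nhds hy)

theorem contDiffAt_xi : ContDiffAt ℝ ∞ ξ y :=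
  hS.smooth_xi.contDiffAt (hS.metric.isOpen.mem_nhds hy)

theorem xi_ne_zero : ξ y ≠ 0 := by
  intro h
  have := hS.eta_xi y hy
  simp [h] at this

/-- The two ways of reducing φ³u by the formula for φ² differ by η(φu)ξ, because φξ = 0. -/
theorem eta_phi (u : Euc n) : G y (ξ y) (φ y u) = 0 := by
  have h1 := hS.phi_phi y hy (φ y u)
  rw [hS.phi_phi y hy u] at h1
  simp only [map_add, map_neg, map_smul, hS.phi_xi y hy, smul_zero, add_zero] at h1
  have h2 : G y (ξ y) (φ y u) • ξ y = 0 := by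
    simpa using h1.symm
  exact (smul_eq_zero.1 h2).resolve_right (hS.xi_ne_zero hy)

theorem phi_eta (u : Euc n) : G y (φ y u) (ξ y) = 0 := by
  rw [hS.symm hy, hS.eta_phi hy]

theorem phi_skew (u v : Euc n) : G y (φ y u) v = - G y u (φ y v) := by
  have h1 := hS.metric_phi y hy u (φ y v)
  rw [hS.phi_phi y hy, hS.eta_phi hy] at h1
  simp only [map_add, map_neg, map_smul, hS.phi_eta hy, smul_eq_mul, mul_zero] at h1
  linarith

/-- `∇_u ξ = - φ u`. -/
theorem cov_xi (u : Euc n) : fderiv ℝ ξ y u + christoffel G y u (ξ y) = - φ y u := by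
  have hξ := (hS.contDiffAt_xi hy).differentiableAt (by simp)
  have hφ := (hS.contDiffAt_phi hy).differentiableAt (by simp)
  -- Differentiating φξ = 0 and using the formula for ∇φ gives φ(∇_uξ) = u − η(u)ξ. Differentiating
  -- |ξ| = 1 gives η(∇_uξ) = 0. Another application of φ then recovers ∇_uξ.
  have h1 : fderiv ℝ (fun z ↦ φ z (ξ y)) y u + φ y (fderiv ℝ ξ y u) = 0 := by
    have e1 : (fun z ↦ φ z (ξ z)) =ᶠ[𝓝 y] fun _ ↦ 0 := by
      filter_upwards [hS.metric.isOpen.mem_nhds hy] with z hz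
      exact hS.phi_xi z hz
    have e2 := e1.fderiv_eq (𝕜 := ℝ)
    rw [(hφ.hasFDerivAt.clm_apply hξ.hasFDerivAt).fderiv] at e2
    have e3 := congrArg (fun L ↦ L u) e2
    rw [(hφ.hasFDerivAt.clm_apply (hasFDerivAt_const (ξ y) y)).fderiv]
    simp at e3 ⊢
    rw [add_comm]
    exact e3
  have h2 := hS.sasakian y hy u (ξ y)
  have h3 : christoffel G y u 0 = 0 := by
    simpa using (isBilinearMap_christoffel G y).smul_right 0 u 0
  rw [hS.phi_xi y hy, h3, hS.eta_xi y hy, hS.symm hy u] at h2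
  have h4 : φ y (fderiv ℝ ξ y u + christoffel G y u (ξ y)) = u - G y (ξ y) u • ξ y := by
    rw [map_add]
    linear_combination (norm := module) h1 - h2
  have h5 : G y (ξ y) (fderiv ℝ ξ y u + christoffel G y u (ξ y)) = 0 := by
    have e1 : (fun z ↦ G z (ξ z) (ξ z)) =ᶠ[𝓝 y] fun _ ↦ 1 := by
      filter_upwards [hS.metric.isOpen.mem_nhds hy] with z hz
      exact hS.eta_xi z hz
    have e2 := hS.metric.fderiv_apply_along (f := id) hy differentiableAt_id hξ hξ u
    simp only [id] at e2
    rw [e1.fderiv_eq] at e2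
    rw [hS.symm hy _ (ξ y)] at e2
    simp only [fderiv_id, fderiv_const_apply, zero_apply, ContinuousLinearMap.id_apply] at e2
    linarith
  have h6 := congrArg (φ y) h4
  rw [hS.phi_phi y hy, h5, map_sub, map_smul, hS.phi_xi y hy] at h6
  simp only [zero_smul, smul_zero, add_zero, sub_zero] at h6
  rw [← h6, neg_neg]

/-- The derivative of `η` along a map, for the Levi-Civita connection of `G`. -/
theorem fderiv_eta_along {F : Type*} [NormedAddCommGroup F] [NormedSpace ℝ F] {f s : F → Euc n}
    {x : F} (hx : f x = y) (hf : DifferentiableAt ℝ f x) (hs : DifferentiableAt ℝ s x) (u : F) :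
    fderiv ℝ (fun z ↦ G (f z) (ξ (f z)) (s z)) x u =
      G y (ξ y) (fderiv ℝ s x u + christoffel G y (fderiv ℝ f x u) (s x)) +
        G y (fderiv ℝ f x u) (φ y (s x)) := by
  subst hx
  have hξ := (hS.contDiffAt_xi hy).differentiableAt (by simp)
  have h1 : HasFDerivAt (fun z ↦ ξ (f z)) ((fderiv ℝ ξ (f x)).comp (fderiv ℝ f x)) x :=
    hξ.hasFDerivAt.comp x hf.hasFDerivAt
  rw [hS.metric.fderiv_apply_along hy hf h1.differentiableAt hs, h1.fderiv,
    ContinuousLinearMap.comp_apply, hS.cov_xi hy, map_neg, neg_apply, hS.phi_skew hy]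
  ring

/-- The derivative of `G(·, φ ·)` along a map, for the Levi-Civita connection of `G`. -/
theorem fderiv_fundamental_along {F : Type*} [NormedAddCommGroup F] [NormedSpace ℝ F]
    {f s t : F → Euc n} {x : F} (hx : f x = y) (hf : DifferentiableAt ℝ f x)
    (hs : DifferentiableAt ℝ s x) (ht : DifferentiableAt ℝ t x) (u : F) :
    fderiv ℝ (fun z ↦ G (f z) (s z) (φ (f z) (t z))) x u =
      G y (fderiv ℝ s x u + christoffel G y (fderiv ℝ f x u) (s x)) (φ y (t x)) +
      G y (s x) (φ y (fderiv ℝ t x u + christoffel G y (fderiv ℝ f x u) (t x))) +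
      (G y (fderiv ℝ f x u) (t x) * G y (ξ y) (s x) -
        G y (ξ y) (t x) * G y (fderiv ℝ f x u) (s x)) := by
  subst hx
  have hφ := (hS.contDiffAt_phi hy).differentiableAt (by simp)
  have h0 : HasFDerivAt (fun z ↦ φ (f z)) ((fderiv ℝ φ (f x)).comp (fderiv ℝ f x)) x :=
    hφ.hasFDerivAt.comp x hf.hasFDerivAt
  have h1 := h0.clm_apply ht.hasFDerivAt
  have h2 : fderiv ℝ (fun z ↦ φ z (t x)) (f x) (fderiv ℝ f x u) =
      fderiv ℝ φ (f x) (fderiv ℝ f x u) (t x) := by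
    rw [(hφ.hasFDerivAt.clm_apply (hasFDerivAt_const (t x) (f x))).fderiv]
    simp
  have h3 := hS.sasakian _ hy (fderiv ℝ f x u) (t x)
  rw [h2] at h3
  have h4 : fderiv ℝ (fun z ↦ φ (f z) (t z)) x u +
      christoffel G (f x) (fderiv ℝ f x u) (φ (f x) (t x)) =
      φ (f x) (fderiv ℝ t x u + christoffel G (f x) (fderiv ℝ f x u) (t x)) +
      (G (f x) (fderiv ℝ f x u) (t x) • ξ (f x) - G (f x) (t x) (ξ (f x)) • fderiv ℝ f x u) := by
    rw [h1.fderiv]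
    simp only [add_apply, ContinuousLinearMap.comp_apply, ContinuousLinearMap.flip_apply, map_add]
    linear_combination (norm := module) h3
  rw [hS.metric.fderiv_apply_along hy hf hs h1.differentiableAt, h4, hS.symm hy (t x)]
  simp only [map_add, map_sub, map_smul, smul_eq_mul]
  rw [hS.symm hy (s x) (ξ (f x)), hS.symm hy (s x) (fderiv ℝ f x u)]
  ring

/-- `φ` is trace free. -/
theorem sum_phi_single : ∑ k, φ y (EuclideanSpace.single k 1) k = 0 := by
  have hi := hS.metric.isInvertible y hy
  -- The dual basis of the standard basis: it turns the coordinate trace of φ into the metric trace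
  -- of the skew form G(φ·,·), which vanishes.
  let c : Fin n → Euc n := fun k ↦ (G y).inverse (EuclideanSpace.proj k)
  have hc : ∀ k v, G y (c k) v = v k := fun k v ↦ by
    simp only [c, hi.self_apply_inverse]
    rfl
  have hB : IsBilinearMap ℝ (fun u v ↦ G y (φ y u) v) :=
    ⟨by simp, by simp, by simp, by simp⟩
  have h1 := metricTrace_skew_selfAdjoint hi (hS.symm hy) hB
    (fun u v ↦ by rw [hS.phi_skew hy, hS.symm hy]) LinearMap.id (by simp)
  simp only [LinearMap.id_apply] at h1
  rw [metricTrace_eq_sum hi hB (fun k ↦ EuclideanSpace.single k 1) c] at h1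
  · rw [← h1]
    refine Finset.sum_congr rfl fun k _ ↦ ?_
    rw [hS.symm hy, hc]
  · intro v
    apply hi.injective
    ext w
    have h2 : w = ∑ k, w k • EuclideanSpace.single k (1 : ℝ) := by
      ext j
      simp [Finset.sum_apply, Pi.single_apply]
    conv_rhs => rw [h2]
    simp [hc, mul_comm]

end IsSasakianOn

theorem sum_smul_single {n : ℕ} (v : Euc n) : ∑ k, v k • EuclideanSpace.single k (1 : ℝ) = v := by
  ext j
  simp [Finset.sum_apply, Pi.single_apply]

theorem sum_apply_single_mul {n : ℕ} (L : Euc n →L[ℝ] ℝ) (v : Euc n) :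
    ∑ k, L (EuclideanSpace.single k 1) * v k = L v := by
  conv_rhs => rw [← sum_smul_single v]
  simp [mul_comm]

theorem sum_apply_apply_single_mul {n : ℕ} (g : Euc n →L[ℝ] Euc n →L[ℝ] ℝ) (u v : Euc n) :
    ∑ i, ∑ j, g (EuclideanSpace.single i 1) (EuclideanSpace.single j 1) * (u i * v j) = g u v := by
  have h1 : ∀ i, ∑ j, g (EuclideanSpace.single i 1) (EuclideanSpace.single j 1) * (u i * v j) =
      g.flip v (EuclideanSpace.single i 1) * u i := by
    intro i
    have h2 := sum_apply_single_mul (g (EuclideanSpace.single i 1)) v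
    rw [ContinuousLinearMap.flip_apply, ← h2, Finset.sum_mul]
    exact Finset.sum_congr rfl fun j _ ↦ by ring
  simp_rw [h1]
  rw [sum_apply_single_mul]
  rfl

theorem ricci_apply {n : ℕ} (G : FormField n) (y u v : Euc n) :
    ricci G y u v = ∑ i, ∑ j, (∑ k, curvature G y (EuclideanSpace.single k 1)
      (EuclideanSpace.single i 1) (EuclideanSpace.single j 1) k) * (u i * v j) := by
  simp [ricci]

namespace IsSasakianOn

/-! ### The Ricci tensor of a Sasakian space form. -/

section Ricci

variable {m : ℕ} {G : FormField (2 * m + 1)}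
  {φ : Euc (2 * m + 1) → Euc (2 * m + 1) →L[ℝ] Euc (2 * m + 1)}
  {ξ : Euc (2 * m + 1) → Euc (2 * m + 1)} {U : Set (Euc (2 * m + 1))}

/-- The Ricci tensor of a Sasakian space form. -/
theorem ricci_eq (hS : IsSasakianOn G φ ξ U) {y : Euc (2 * m + 1)} (hy : y ∈ U) {c : ℝ}
    (hR : ∀ X Y Z, curvature G y X Y Z =
      (-((c - 1) / 4)) • (G y (ξ y) Z • (G y (ξ y) Y • X - G y (ξ y) X • Y)
          + (G y Y Z * G y (ξ y) X - G y X Z * G y (ξ y) Y) • ξ y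
          + G y (φ y X) Z • φ y Y + (2 * G y (φ y X) Y) • φ y Z - G y (φ y Y) Z • φ y X)
        + ((c + 3) / 4) • (G y Y Z • X - G y X Z • Y)) (u v : Euc (2 * m + 1)) :
    ricci G y u v = ((c - 1) / 2 + m * (c + 3) / 2) * G y u v +
      (-(m + 1) * (c - 1) / 2) * G y (ξ y) u * G y (ξ y) v := by
  have hsum : ∀ Y Z, ∑ k, curvature G y (EuclideanSpace.single k 1) Y Z k =
      ((c - 1) / 2 + m * (c + 3) / 2) * G y Y Z +
      (-(m + 1) * (c - 1) / 2) * G y (ξ y) Y * G y (ξ y) Z := by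
    intro Y Z
    -- Skewness of φ rewrites most summands as a functional at the k-th basis vector times a k-th
    -- coordinate, so that summation contracts them. The exceptions are the constant term, counted
    -- 2m + 1 times, and the trace of φ, which is zero.
    have e1 : ∀ k, curvature G y (EuclideanSpace.single k 1) Y Z k =
        (-((c - 1) / 4) * (G y (ξ y) Z * G y (ξ y) Y) + (c + 3) / 4 * G y Y Z) * 1
        + (c - 1) / 4 * G y (ξ y) Z * (G y (ξ y) (EuclideanSpace.single k 1) * Y k)
        - (c - 1) / 4 * G y Y Z * (G y (ξ y) (EuclideanSpace.single k 1) * ξ y k)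
        + (c - 1) / 4 * G y (ξ y) Y * (G y Z (EuclideanSpace.single k 1) * ξ y k)
        + (c - 1) / 4 * (G y (φ y Z) (EuclideanSpace.single k 1) * φ y Y k)
        + (c - 1) / 2 * (G y (φ y Y) (EuclideanSpace.single k 1) * φ y Z k)
        + (c - 1) / 4 * G y (φ y Y) Z * φ y (EuclideanSpace.single k 1) k
        - (c + 3) / 4 * (G y Z (EuclideanSpace.single k 1) * Y k) := by
      intro k
      rw [hR, hS.phi_skew hy (EuclideanSpace.single k 1), hS.phi_skew hy (EuclideanSpace.single k 1),
        hS.symm hy (EuclideanSpace.single k 1), hS.symm hy (EuclideanSpace.single k 1),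
        hS.symm hy (EuclideanSpace.single k 1)]
      simp
      ring
    simp_rw [e1]
    simp only [Finset.sum_add_distrib, Finset.sum_sub_distrib, ← Finset.mul_sum,
      sum_apply_single_mul, hS.sum_phi_single hy]
    have e2 := hS.metric_phi y hy Y Z
    have e3 := hS.symm hy (φ y Z) (φ y Y)
    rw [e3, e2, hS.eta_xi y hy, hS.symm hy Z (ξ y), hS.symm hy Z Y]
    simp
    ring
  rw [ricci_apply]
  simp_rw [hsum]
  have h1 := sum_apply_apply_single_mul (G y) u v
  have h2 := sum_apply_single_mul (G y (ξ y)) u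
  have h3 := sum_apply_single_mul (G y (ξ y)) v
  rw [← h1, ← h2, ← h3, Finset.mul_sum, mul_assoc, Finset.sum_mul_sum, Finset.mul_sum,
    ← Finset.sum_add_distrib]
  refine Finset.sum_congr rfl fun i _ ↦ ?_
  rw [Finset.mul_sum, Finset.mul_sum, ← Finset.sum_add_distrib]
  refine Finset.sum_congr rfl fun j _ ↦ ?_
  ring

end Ricci

/-! ### The metric a G + b η⊗η and its connection. -/

section Deformation

variable {n : ℕ} {G : FormField n} {φ : Euc n → Euc n →L[ℝ] Euc n} {ξ : Euc n → Euc n}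
  {U : Set (Euc n)} (hS : IsSasakianOn G φ ξ U) {a b : ℝ} {Gh : FormField n} (ha : a ≠ 0)
  (hab : a + b ≠ 0)
  (hGh : ∀ y ∈ U, ∀ u v, Gh y u v = a * G y u v + b * G y (ξ y) u * G y (ξ y) v)
include hS ha hab hGh

omit ha hab in
theorem deform_xi {y : Euc n} (hy : y ∈ U) (u : Euc n) :
    Gh y u (ξ y) = (a + b) * G y (ξ y) u := by
  rw [hGh y hy, hS.eta_xi y hy, hS.symm hy u]
  ring

/-- The form `a G + b η ⊗ η` is a metric. -/
theorem isMetricOn_deform : IsMetricOn Gh U where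
  isOpen := hS.metric.isOpen
  contDiffOn := by
    refine contDiffOn_clm_apply.2 fun u ↦ contDiffOn_clm_apply.2 fun v y hy ↦ ?_
    have h1 : (fun z ↦ Gh z u v) =ᶠ[𝓝 y]
        fun z ↦ a * G z u v + b * G z (ξ z) u * G z (ξ z) v := by
      filter_upwards [hS.metric.isOpen.mem_nhds hy] with z hz
      exact hGh z hz u v
    refine (ContDiffAt.congr_of_eventuallyEq ?_ h1).contDiffWithinAt
    have hG := hS.metric.contDiffAt hy
    have hη := hG.clm_apply (hS.contDiffAt_xi hy)
    exact (contDiffAt_const.mul ((hG.clm_apply contDiffAt_const).clm_apply contDiffAt_const)).add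
      ((contDiffAt_const.mul (hη.clm_apply contDiffAt_const)).mul (hη.clm_apply contDiffAt_const))
  symm y hy u v := by
    rw [hGh y hy, hGh y hy, hS.symm hy u v]
    ring
  isInvertible y hy := by
    -- Testing against ξ gives (a + b)η(u) = 0, hence η(u) = 0. Testing against u itself then leaves
    -- a G(u,u) = 0.
    refine isInvertible_of_nondegenerate fun u hu ↦ ?_
    have h1 := hu (ξ y)
    rw [hS.deform_xi hGh hy] at h1
    have h2 : G y (ξ y) u = 0 := (mul_eq_zero.1 h1).resolve_left hab
    have h3 := hu u
    rw [hGh y hy, h2, mul_zero, add_zero] at h3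
    by_contra h0
    exact (hS.pos y hy u h0).ne' ((mul_eq_zero.1 h3).resolve_left ha)

/-- The Levi-Civita connection of `a G + b η ⊗ η`. -/
theorem christoffel_deform {y : Euc n} (hy : y ∈ U) (u v : Euc n) :
    christoffel Gh y u v =
      christoffel G y u v - (b / a) • (G y (ξ y) u • φ y v + G y (ξ y) v • φ y u) := by
  have hM := hS.isMetricOn_deform ha hab hGh
  have hd : ∀ u v w, fderiv ℝ Gh y u v w = a * fderiv ℝ G y u v w +
      b * ((G y (ξ y) (christoffel G y u v) + G y u (φ y v)) * G y (ξ y) w +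
        G y (ξ y) v * (G y (ξ y) (christoffel G y u w) + G y u (φ y w))) := by
    intro u v w
    have h1 : (fun z ↦ Gh z v w) =ᶠ[𝓝 y]
        fun z ↦ a * G z v w + b * (G z (ξ z) v * G z (ξ z) w) := by
      filter_upwards [hS.metric.isOpen.mem_nhds hy] with z hz
      rw [hGh z hz, mul_assoc]
    have hη : ∀ v, HasFDerivAt (fun z ↦ G z (ξ z) v) (fderiv ℝ (fun z ↦ G z (ξ z) v) y) y :=
      fun v ↦ (((hS.metric.differentiableAt hy).clm_apply ((hS.contDiffAt_xi hy).differentiableAt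
        (by simp))).clm_apply (differentiableAt_const v)).hasFDerivAt
    have hη' : ∀ v, fderiv ℝ (fun z ↦ G z (ξ z) v) y u =
        G y (ξ y) (christoffel G y u v) + G y u (φ y v) := by
      intro v
      have := hS.fderiv_eta_along (f := id) (s := fun _ ↦ v) hy rfl differentiableAt_id
        (differentiableAt_const v) u
      simpa using this
    have hGd : HasFDerivAt (fun z ↦ G z v w) (fderiv ℝ (fun z ↦ G z v w) y) y :=
      (((hS.metric.differentiableAt hy).clm_apply (differentiableAt_const v)).clm_apply
        (differentiableAt_const w)).hasFDerivAt
    have h2 : HasFDerivAt (fun z ↦ a * G z v w + b * (G z (ξ z) v * G z (ξ z) w)) _ y :=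
      (hGd.const_mul a).add (((hη v).mul (hη w)).const_mul b)
    rw [hM.fderiv_apply hy, h1.fderiv_eq, h2.fderiv, hS.metric.fderiv_apply hy]
    simp [hη']
    ring
  -- In the Koszul formula the terms η(Γ) combine to 2η(Γ(u,v))η(w), the b-part of the new metric on
  -- Γ. By skewness of φ the others add up to 2b(η(u)G(v,φw) + η(v)G(u,φw)), which is what the
  -- correction with factor b/a contributes.
  symm
  apply hM.eq_christoffel hy
  intro w
  rw [hd, hd, hd, hGh y hy]
  have h1 := hS.metric.apply_christoffel hy u v w
  have s1 := hS.phi_skew hy u v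
  have s2 := hS.phi_skew hy u w
  have s3 := hS.phi_skew hy v w
  have c1 := hS.metric.christoffel_symm hy u v
  have c2 := hS.metric.christoffel_symm hy u w
  have c3 := hS.metric.christoffel_symm hy v w
  have t1 := hS.symm hy v (φ y u)
  have t2 := hS.symm hy w (φ y u)
  have t3 := hS.symm hy w (φ y v)
  have hba : a * (b / a) = b := by field_simp
  simp only [map_sub, map_add, map_smul, sub_apply, add_apply, smul_apply, smul_eq_mul,
    hS.eta_phi hy]
  rw [← c1, ← c2, ← c3, t1, t2, t3, s1, s2, s3]
  linear_combination a * h1 + 2 * (G y (ξ y) u * G y v (φ y w) +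
    G y (ξ y) v * G y u (φ y w)) * hba

end Deformation

end IsSasakianOn

/-! ### Derivatives along a map and curvature for the deformed connection. -/

theorem covAlong_add {k n : ℕ} (G : FormField n) (f s : Euc k → Euc n) (x u v : Euc k) :
    covAlong G f s x (u + v) = covAlong G f s x u + covAlong G f s x v := by
  simp only [covAlong, map_add, (isBilinearMap_christoffel G (f x)).add_left]
  abel

theorem covAlong_smul {k n : ℕ} (G : FormField n) (f s : Euc k → Euc n) (x : Euc k) (r : ℝ)
    (u : Euc k) : covAlong G f s x (r • u) = r • covAlong G f s x u := by
  simp only [covAlong, map_smul, (isBilinearMap_christoffel G (f x)).smul_left, smul_add]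

/-- A vector orthogonal to a normal vector of a hypersurface is tangent. -/
theorem exists_eq_of_orthogonal {V W : Type*} [AddCommGroup V] [Module ℝ V]
    [FiniteDimensional ℝ V] [AddCommGroup W] [Module ℝ W] [FiniteDimensional ℝ W]
    (hdim : Module.finrank ℝ V + 1 = Module.finrank ℝ W) (l : W →ₗ[ℝ] ℝ) (hl : l ≠ 0)
    (L : V →ₗ[ℝ] W) (hL : Function.Injective L) (hlL : ∀ u, l (L u) = 0) {w : W} (hw : l w = 0) :
    ∃ u, L u = w := by
  have h1 : LinearMap.range L ≤ LinearMap.ker l := by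
    rintro _ ⟨u, rfl⟩
    exact hlL u
  have h2 := LinearMap.finrank_range_of_inj hL
  have h3 := l.finrank_range_add_finrank_ker
  have h4 : LinearMap.range l = ⊤ := LinearMap.range_eq_top.2 (LinearMap.surjective hl)
  rw [h4, finrank_top, Module.finrank_self] at h3
  have h5 : LinearMap.range L = LinearMap.ker l :=
    Submodule.eq_of_le_of_finrank_eq h1 (by omega)
  have h6 : w ∈ LinearMap.range L := by
    rw [h5]
    exact hw
  exact h6

namespace IsSasakianOn

section Deformation

variable {k n : ℕ} {G : FormField n} {φ : Euc n → Euc n →L[ℝ] Euc n} {ξ : Euc n → Euc n}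
  {U : Set (Euc n)} (hS : IsSasakianOn G φ ξ U) {a b : ℝ} {Gh : FormField n} (ha : a ≠ 0)
  (hab : a + b ≠ 0)
  (hGh : ∀ y ∈ U, ∀ u v, Gh y u v = a * G y u v + b * G y (ξ y) u * G y (ξ y) v)
  {f s t : Euc k → Euc n} {x : Euc k} (hx : f x ∈ U) (hf : DifferentiableAt ℝ f x)
  (hs : DifferentiableAt ℝ s x) (ht : DifferentiableAt ℝ t x)
include hS ha hab hGh hx hf hs

/-- The derivative of `η` along a map, for the Levi-Civita connection of `a G + b η ⊗ η`. -/
theorem fderiv_eta_deform (u : Euc k) :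
    fderiv ℝ (fun z ↦ G (f z) (ξ (f z)) (s z)) x u =
      G (f x) (ξ (f x)) (covAlong Gh f s x u) + G (f x) (fderiv ℝ f x u) (φ (f x) (s x)) := by
  -- The correction to the connection lies in the image of φ, which η annihilates; the formula is
  -- therefore the same as for G.
  rw [hS.fderiv_eta_along hx rfl hf hs, covAlong, hS.christoffel_deform ha hab hGh hx]
  simp only [map_add, map_sub, map_smul, hS.eta_phi hx, smul_zero, add_zero, sub_zero]

include ht in
/-- The derivative of `G(·, φ ·)` along a map, for the Levi-Civita connection of
`a G + b η ⊗ η`. -/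
theorem fderiv_fundamental_deform (u : Euc k) :
    fderiv ℝ (fun z ↦ G (f z) (s z) (φ (f z) (t z))) x u =
      G (f x) (covAlong Gh f s x u) (φ (f x) (t x)) +
      G (f x) (s x) (φ (f x) (covAlong Gh f t x u)) +
      (1 + b / a) * (G (f x) (fderiv ℝ f x u) (t x) * G (f x) (ξ (f x)) (s x) -
        G (f x) (ξ (f x)) (t x) * G (f x) (fderiv ℝ f x u) (s x)) := by
  rw [hS.fderiv_fundamental_along hx rfl hf hs ht, covAlong, covAlong,
    hS.christoffel_deform ha hab hGh hx, hS.christoffel_deform ha hab hGh hx]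
  -- The correction terms carrying η(df u) cancel by skewness. The remaining ones reproduce the ∇φ
  -- term of G with factor b/a, whence 1 + b/a.
  have h1 := hS.metric_phi _ hx (s x) (t x)
  have h2 := hS.metric_phi _ hx (fderiv ℝ f x u) (t x)
  have h3 := hS.metric_phi _ hx (fderiv ℝ f x u) (s x)
  have h5 : G (f x) (s x) (φ (f x) (φ (f x) (t x))) = - G (f x) (φ (f x) (s x)) (φ (f x) (t x)) := by
    rw [hS.phi_skew hx, neg_neg]
  have h6 : G (f x) (s x) (φ (f x) (φ (f x) (fderiv ℝ f x u))) =
      - G (f x) (φ (f x) (fderiv ℝ f x u)) (φ (f x) (s x)) := by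
    rw [hS.symm hx, hS.phi_skew hx]
  simp only [map_sub, map_add, map_smul, sub_apply, add_apply, smul_apply, smul_eq_mul, h5, h6,
    h1, h2, h3]
  ring

omit hx hf hs

/-- The `η`-component of the curvature of `a G + b η ⊗ η`. -/
theorem eta_curvature_deform {y : Euc n} (hy : y ∈ U) (X Y Z : Euc n) :
    G y (ξ y) (curvature Gh y X Y Z) =
      (1 + b / a) * (G y Y Z * G y (ξ y) X - G y X Z * G y (ξ y) Y) := by
  have hM := hS.isMetricOn_deform ha hab hGh
  have hΓ : ∀ Y Z, DifferentiableAt ℝ (fun z ↦ christoffel Gh z Y Z) y := fun Y Z ↦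
    (hM.contDiffAt_christoffel (f := id) hy contDiffAt_id contDiffAt_const
      contDiffAt_const).differentiableAt (by simp)
  have hη : ContDiffAt ℝ ∞ (fun z ↦ G z (ξ z) Z) y :=
    ((hS.metric.contDiffAt hy).clm_apply (hS.contDiffAt_xi hy)).clm_apply contDiffAt_const
  -- The Hessian of the function η(Z), for constant Z. Its symmetry in X and Y yields the claim: all
  -- terms are symmetric except those that antisymmetrize to η of the curvature and the one with
  -- factor 1 + b/a.
  have key : ∀ X Y, fderiv ℝ (fun z ↦ fderiv ℝ (fun z ↦ G z (ξ z) Z) z Y) y X =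
      G y (ξ y) (fderiv ℝ (fun z ↦ christoffel Gh z Y Z) y X) +
      G y (ξ y) (christoffel Gh y X (christoffel Gh y Y Z)) +
      G y X (φ y (christoffel Gh y Y Z)) + G y (christoffel Gh y X Y) (φ y Z) +
      G y Y (φ y (christoffel Gh y X Z)) +
      (1 + b / a) * (G y X Z * G y (ξ y) Y - G y (ξ y) Z * G y X Y) := by
    intro X Y
    have h1 : (fun z ↦ fderiv ℝ (fun z ↦ G z (ξ z) Z) z Y) =ᶠ[𝓝 y]
        fun z ↦ G z (ξ z) (christoffel Gh z Y Z) + G z Y (φ z Z) := by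
      filter_upwards [hS.metric.isOpen.mem_nhds hy] with z hz
      have := hS.fderiv_eta_deform ha hab hGh (f := id) (s := fun _ ↦ Z) hz differentiableAt_id
        (differentiableAt_const Z) Y
      simpa [covAlong] using this
    have h2 := hS.fderiv_eta_deform ha hab hGh (f := id) (s := fun z ↦ christoffel Gh z Y Z) hy
      differentiableAt_id (hΓ Y Z) X
    have h3 := hS.fderiv_fundamental_deform ha hab hGh (f := id) (s := fun _ ↦ Y) (t := fun _ ↦ Z)
      hy differentiableAt_id (differentiableAt_const Y) (differentiableAt_const Z) X
    simp only [covAlong, id, fderiv_id, ContinuousLinearMap.id_apply, fderiv_fun_const,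
      Pi.zero_apply, zero_apply, zero_add, map_add] at h2 h3
    have hG := (hS.metric.contDiffAt hy).differentiableAt (by simp)
    have hd1 : DifferentiableAt ℝ (fun z ↦ G z (ξ z) (christoffel Gh z Y Z)) y :=
      (hG.clm_apply ((hS.contDiffAt_xi hy).differentiableAt (by simp))).clm_apply (hΓ Y Z)
    have hd2 : DifferentiableAt ℝ (fun z ↦ G z Y (φ z Z)) y :=
      (hG.clm_apply (differentiableAt_const Y)).clm_apply
        (((hS.contDiffAt_phi hy).differentiableAt (by simp)).clm_apply (differentiableAt_const Z))
    rw [h1.fderiv_eq, fderiv_fun_add hd1 hd2, add_apply, h2, h3]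
    ring
  have h4 := fderiv_fderiv_symm hη X Y
  rw [key X Y, key Y X, hM.christoffel_symm hy Y X, hS.symm hy Y X] at h4
  simp only [curvature, map_sub, map_add]
  linear_combination h4

end Deformation

end IsSasakianOn

/-! ### The ξ-component of the bitension field. -/

namespace IsSasakianOn

variable {k n : ℕ} {G : FormField n} {φ : Euc n → Euc n →L[ℝ] Euc n} {ξ : Euc n → Euc n}
  {U : Set (Euc n)} (hS : IsSasakianOn G φ ξ U) {a b : ℝ} {Gh : FormField n} (ha : a ≠ 0)
  (hab : a + b ≠ 0)
  (hGh : ∀ y ∈ U, ∀ u v, Gh y u v = a * G y u v + b * G y (ξ y) u * G y (ξ y) v)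
  {f s : Euc k → Euc n} {O : Set (Euc k)} (hM : IsMetricOn (pullbackForm Gh f) O)
  (hf : ContDiffOn ℝ ∞ f O) (hU : Set.MapsTo f O U) (hs : ContDiffOn ℝ ∞ s O)
  (hsn : ∀ x ∈ O, ∀ u, G (f x) (s x) (fderiv ℝ f x u) = 0)
  (hsξ : ∀ x ∈ O, G (f x) (ξ (f x)) (s x) = 0) {x : Euc k} (hx : x ∈ O)
include hS ha hab hGh hM hf hU hs hsn hsξ hx

/-- The `η`-component of the second covariant derivative of a normal field along an immersion
that is tangent to `ξ`, at a point where `φ` of the field is tangent. -/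
theorem eta_secondDerivative {w : Euc k} (hw : fderiv ℝ f x w = φ (f x) (s x)) (u v : Euc k) :
    G (f x) (ξ (f x)) (covAlong Gh f (fun y ↦ covAlong Gh f s y v) x u -
      covAlong Gh f s x (christoffel (pullbackForm Gh f) x u v)) =
    - G (f x) (fderiv ℝ f x v) (φ (f x) (covAlong Gh f s x u)) -
      G (f x) (fderiv ℝ f x u) (φ (f x) (covAlong Gh f s x v)) := by
  have hO := hM.isOpen
  have hGhM := hS.isMetricOn_deform ha hab hGh
  have hfat : ∀ y ∈ O, ContDiffAt ℝ ∞ f y := fun y hy ↦ hf.contDiffAt (hO.mem_nhds hy)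
  have hsat : ∀ y ∈ O, ContDiffAt ℝ ∞ s y := fun y hy ↦ hs.contDiffAt (hO.mem_nhds hy)
  have hfd : ∀ y ∈ O, DifferentiableAt ℝ f y := fun y hy ↦ (hfat y hy).differentiableAt (by simp)
  have hsd : ∀ y ∈ O, DifferentiableAt ℝ s y := fun y hy ↦ (hsat y hy).differentiableAt (by simp)
  have hfx := hU hx
  have hfv : DifferentiableAt ℝ (fun y ↦ fderiv ℝ f y v) x :=
    (contDiffAt_fderiv_apply (hfat x hx) v).differentiableAt (by simp)
  have hcov : DifferentiableAt ℝ (fun y ↦ covAlong Gh f s y v) x :=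
    ((contDiffAt_fderiv_apply (hsat x hx) v).add (hGhM.contDiffAt_christoffel hfx (hfat x hx)
      (contDiffAt_fderiv_apply (hfat x hx) v) (hsat x hx))).differentiableAt (by simp)
  -- First derivative of η(s) = 0. Differentiating this relation again, as an identity near x,
  -- produces the second covariant derivative.
  have hη : ∀ y ∈ O, ∀ u, G (f y) (ξ (f y)) (covAlong Gh f s y u) =
      - G (f y) (fderiv ℝ f y u) (φ (f y) (s y)) := by
    intro y hy u
    have h1 := hS.fderiv_eta_deform ha hab hGh (hU hy) (hfd y hy) (hsd y hy) u
    have h2 : (fun z ↦ G (f z) (ξ (f z)) (s z)) =ᶠ[𝓝 y] fun _ ↦ 0 := by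
      filter_upwards [hO.mem_nhds hy] with z hz
      exact hsξ z hz
    rw [h2.fderiv_eq] at h1
    simp only [fderiv_fun_const, Pi.zero_apply, zero_apply] at h1
    linarith
  have h1 := hS.fderiv_eta_deform ha hab hGh hfx (hfd x hx) hcov u
  have h2 : (fun z ↦ G (f z) (ξ (f z)) (covAlong Gh f s z v)) =ᶠ[𝓝 x]
      fun z ↦ - G (f z) (fderiv ℝ f z v) (φ (f z) (s z)) := by
    filter_upwards [hO.mem_nhds hx] with z hz
    exact hη z hz v
  have h3 := hS.fderiv_fundamental_deform ha hab hGh hfx (hfd x hx) hfv (hsd x hx) u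
  rw [h2.fderiv_eq, fderiv_fun_neg, neg_apply, h3, hsξ x hx, hS.symm hfx _ (s x),
    hsn x hx] at h1
  have h4 : covAlong Gh f (fun y ↦ fderiv ℝ f y v) x u = localSecondForm Gh f x u v +
      fderiv ℝ f x (christoffel (pullbackForm Gh f) x u v) := by
    simp only [covAlong, localSecondForm]
    abel
  -- The second fundamental form of `Gh` is `Gh`-normal and φs is tangent. Since η(φs) = 0, pairing
  -- with φs in `Gh` is a times pairing in G.
  have h5 : G (f x) (localSecondForm Gh f x u v) (φ (f x) (s x)) = 0 := by
    have e1 := apply_localSecondForm hGhM hM hx hfx (hfat x hx) u v w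
    rw [hGh _ hfx, hw, hS.eta_phi hfx, mul_zero, add_zero] at e1
    exact (mul_eq_zero.1 e1).resolve_left ha
  rw [map_sub, hη x hx]
  rw [h4, map_add, add_apply, h5] at h1
  linarith

/-- If the bitension field of a normal field `s` along a hypersurface tangent to `ξ` vanishes, then
`|s|` is stationary in the direction of `φ s`. -/
theorem fderiv_normSq_eq_zero (hk : k + 1 = n) (hinj : Function.Injective (fderiv ℝ f x))
    (hsx : s x ≠ 0) (hbi : localBitension Gh f s x = 0) :
    ∃ w, fderiv ℝ f x w = φ (f x) (s x) ∧
      fderiv ℝ (fun z ↦ G (f z) (s z) (s z)) x w = 0 := by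
  have hO := hM.isOpen
  have hGhM := hS.isMetricOn_deform ha hab hGh
  have hfat := hf.contDiffAt (hO.mem_nhds hx)
  have hsat := hs.contDiffAt (hO.mem_nhds hx)
  have hfd : DifferentiableAt ℝ f x := hfat.differentiableAt (by simp)
  have hsd : DifferentiableAt ℝ s x := hsat.differentiableAt (by simp)
  have hfx := hU hx
  have hss : 0 < G (f x) (s x) (s x) := hS.pos _ hfx _ hsx
  have hl : (G (f x) (s x)).toLinearMap ≠ 0 := fun h ↦ hss.ne' (LinearMap.congr_fun h (s x))
  have htan : ∀ w, G (f x) (s x) w = 0 → ∃ u, fderiv ℝ f x u = w := fun w hw ↦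
    exists_eq_of_orthogonal (by simpa using hk) _ hl (fderiv ℝ f x).toLinearMap hinj (hsn x hx) hw
  obtain ⟨w, hw⟩ := htan (φ (f x) (s x)) (by
    have h1 := hS.phi_skew hfx (s x) (s x)
    rw [hS.symm hfx] at h1
    linarith)
  refine ⟨w, hw, ?_⟩
  set g := pullbackForm Gh f x with hg
  have hgi : g.IsInvertible := hM.isInvertible x hx
  have hgs : ∀ u v, g u v = g v u := hM.symm x hx
  have hgap : ∀ u v, g u v = Gh (f x) (fderiv ℝ f x u) (fderiv ℝ f x v) := fun _ _ ↦ rfl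
  -- the trace of `G(·, φ ∇ s)` vanishes
  let T : Euc k → Euc k → ℝ := fun u v ↦
    G (f x) (fderiv ℝ f x u) (φ (f x) (covAlong Gh f s x v))
  have hTbil : IsBilinearMap ℝ T :=
    ⟨by simp [T], by simp [T], by simp [T, covAlong_add], by simp [T, covAlong_smul]⟩
  have hT : metricTrace g T = 0 := by
    have h1 := congrArg (G (f x) (ξ (f x))).toLinearMap hbi
    rw [localBitension, laplacianAlong, neg_neg, map_sub, map_metricTrace, map_metricTrace,
      map_zero] at h1
    simp only [ContinuousLinearMap.coe_coe] at h1
    -- Both terms of the η-curvature vanish: s is normal and η(s) = 0.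
    have h2 : ∀ u v, G (f x) (ξ (f x)) (curvature Gh (f x) (fderiv ℝ f x u) (s x)
        (fderiv ℝ f x v)) = 0 := by
      intro u v
      rw [hS.eta_curvature_deform ha hab hGh hfx, hsξ x hx, hsn x hx]
      ring
    simp only [h2, hS.eta_secondDerivative ha hab hGh hM hf hU hs hsn hsξ hx hw,
      metricTrace_zero, sub_zero] at h1
    simp only [sub_eq_add_neg, metricTrace_add, metricTrace_neg] at h1
    have h3 := metricTrace_flip hgi hgs hTbil
    have h4 : - metricTrace g (fun u v ↦ T v u) + - metricTrace g T = 0 := h1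
    linarith
  -- decomposition of `∇ s` into its normal and tangential part
  let r : Euc k →ₗ[ℝ] ℝ :=
    { toFun := fun v ↦ G (f x) (s x) (covAlong Gh f s x v) / G (f x) (s x) (s x)
      map_add' := fun u v ↦ by rw [covAlong_add, map_add, add_div]
      map_smul' := fun c v ↦ by
        rw [covAlong_smul, map_smul, smul_eq_mul, mul_div_assoc]; rfl }
  let R : Euc k →ₗ[ℝ] Euc n :=
    { toFun := fun v ↦ covAlong Gh f s x v - r v • s x
      map_add' := fun u v ↦ by rw [covAlong_add, map_add]; module
      map_smul' := fun c v ↦ by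
        rw [covAlong_smul, map_smul, smul_eq_mul, RingHom.id_apply]; module }
  -- A left inverse of the differential makes the preimage `t` of the tangential part a linear map.
  obtain ⟨P, hP⟩ := LinearMap.exists_leftInverse_of_injective (fderiv ℝ f x).toLinearMap
    (LinearMap.ker_eq_bot.2 hinj)
  let t : Euc k →ₗ[ℝ] Euc k := P.comp R
  have ht : ∀ v, fderiv ℝ f x (t v) = covAlong Gh f s x v - r v • s x := by
    intro v
    have h1 : G (f x) (s x) (covAlong Gh f s x v - r v • s x) = 0 := by
      have : r v * G (f x) (s x) (s x) = G (f x) (s x) (covAlong Gh f s x v) :=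
        div_mul_cancel₀ _ hss.ne'
      rw [map_sub, map_smul, smul_eq_mul, this, sub_self]
    obtain ⟨u, hu⟩ := htan _ h1
    have h2 : t v = P (fderiv ℝ f x u) := by
      rw [hu]
      rfl
    have h3 : P (fderiv ℝ f x u) = u := LinearMap.congr_fun hP u
    rw [h2, h3, hu]
  -- Because η(s) = 0, normality for G and for `Gh` coincide on s.
  have hsn' : ∀ y ∈ O, ∀ u, Gh (f y) (fderiv ℝ f y u) (s y) = 0 := by
    intro y hy u
    rw [hGh _ (hU hy), hsξ y hy, hS.symm (hU hy), hsn y hy]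
    ring
  -- Weingarten's relation: g(u, t v) = −Gh(∇_v(df u), s). The right side is symmetric since the
  -- connection has no torsion.
  have htsymm : ∀ u v, g (t u) v = g u (t v) := by
    have h1 : ∀ u v, Gh (f x) (fderiv ℝ f x u) (covAlong Gh f s x v) =
        - Gh (f x) (covAlong Gh f (fun y ↦ fderiv ℝ f y u) x v) (s x) := by
      intro u v
      have e1 := hGhM.fderiv_apply_along hfx hfd
        ((contDiffAt_fderiv_apply hfat u).differentiableAt (by simp)) hsd v
      have e2 : (fun z ↦ Gh (f z) (fderiv ℝ f z u) (s z)) =ᶠ[𝓝 x] fun _ ↦ 0 := by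
        filter_upwards [hO.mem_nhds hx] with z hz
        exact hsn' z hz u
      rw [e2.fderiv_eq] at e1
      simp only [fderiv_fun_const, Pi.zero_apply, zero_apply] at e1
      simp only [covAlong]
      linarith
    have h2 : ∀ u v, g u (t v) = Gh (f x) (fderiv ℝ f x u) (covAlong Gh f s x v) := by
      intro u v
      rw [hgap, ht, map_sub, map_smul, hsn' x hx, smul_zero, sub_zero]
    intro u v
    rw [hgs, h2, h2, h1, h1]
    simp only [covAlong]
    rw [fderiv_fderiv_symm hfat, hGhM.christoffel_symm hfx]
  -- the trace in terms of the decomposition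
  have hdec : ∀ u v, T u v = g u w * (a⁻¹ • r) v +
      G (f x) (fderiv ℝ f x u) (φ (f x) (fderiv ℝ f x (t v))) := by
    intro u v
    -- Here φs = df w has no η-component, so replacing G by the induced `Gh` costs the factor a;
    -- this is the origin of a⁻¹ in front of r.
    have h1 : g u w = a * G (f x) (fderiv ℝ f x u) (φ (f x) (s x)) := by
      rw [hgap, hw, hGh _ hfx, hS.eta_phi hfx]
      ring
    have h2 : covAlong Gh f s x v = r v • s x + fderiv ℝ f x (t v) := by
      rw [ht]
      abel
    simp only [T]
    rw [h1, h2, map_add, map_add, map_smul, map_smul]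
    simp only [LinearMap.smul_apply, smul_eq_mul]
    field_simp
  have hfun : T = fun u v ↦ g u w * (a⁻¹ • r) v +
      G (f x) (fderiv ℝ f x u) (φ (f x) (fderiv ℝ f x (t v))) := by
    ext u v
    exact hdec u v
  rw [hfun, metricTrace_add, metricTrace_mul hgi hgs] at hT
  have hskew := metricTrace_skew_selfAdjoint hgi hgs
    (C := fun u v ↦ G (f x) (fderiv ℝ f x u) (φ (f x) (fderiv ℝ f x v)))
    ⟨by simp, by simp, by simp, by simp⟩
    (fun u v ↦ by rw [← hS.phi_skew hfx, hS.symm hfx]) t htsymm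
  rw [hskew, add_zero, LinearMap.smul_apply, smul_eq_mul] at hT
  have hr : r w = 0 := (mul_eq_zero.1 hT).resolve_left (inv_ne_zero ha)
  have hr' : G (f x) (s x) (covAlong Gh f s x w) = 0 :=
    (div_eq_zero_iff.1 hr).resolve_right hss.ne'
  -- With η(s) = 0 the two squared norms of s are proportional, so r(w) = 0 passes from the
  -- connection of `Gh` to the derivative of G(s,s).
  have hGhs : (fun z ↦ Gh (f z) (s z) (s z)) =ᶠ[𝓝 x] fun z ↦ a * G (f z) (s z) (s z) := by
    filter_upwards [hO.mem_nhds hx] with z hz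
    rw [hGh _ (hU hz), hsξ z hz]
    ring
  have h1 := hGhM.fderiv_apply_along hfx hfd hsd hsd w
  have h2 : Gh (f x) (s x) (covAlong Gh f s x w) = 0 := by
    rw [hGh _ hfx, hr', hsξ x hx]
    ring
  have h3 : DifferentiableAt ℝ (fun z ↦ G (f z) (s z) (s z)) x :=
    ((((hS.metric.contDiffAt hfx).comp x hfat).clm_apply hsat).clm_apply hsat).differentiableAt
      (by simp)
  rw [hGhM.symm _ hfx _ (s x), hGhs.fderiv_eq, fderiv_const_mul h3] at h1
  simp only [covAlong] at h2
  rw [h2, smul_apply, smul_eq_mul, add_zero] at h1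
  exact (mul_eq_zero.1 h1).resolve_left ha

end IsSasakianOn

/-! ### Geometric data of a manifold read in charts. -/

section Charts

variable {n : ℕ} {P : Type*} [TopologicalSpace P] [ChartedSpace (EuclideanSpace ℝ (Fin n)) P]
  [IsManifold (𝓡 n) ∞ P]

theorem isInvertible_coords {q p : P} (hp : p ∈ (extChartAt (𝓡 n) q).source) :
    (coords (n := n) q p).IsInvertible :=
  isInvertible_mfderiv_extChartAt hp

theorem coords_ofCoords {q p : P} (hp : p ∈ (extChartAt (𝓡 n) q).source)
    (u : EuclideanSpace ℝ (Fin n)) : coords q p (ofCoords q p u) = u :=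
  (isInvertible_coords hp).self_apply_inverse u

theorem ofCoords_coords {q p : P} (hp : p ∈ (extChartAt (𝓡 n) q).source)
    (u : TangentSpace (𝓡 n) p) : ofCoords q p (coords q p u) = u :=
  (isInvertible_coords hp).inverse_apply_self u

theorem ofCoords_ne_zero {q p : P} (hp : p ∈ (extChartAt (𝓡 n) q).source)
    {u : EuclideanSpace ℝ (Fin n)} (hu : u ≠ 0) : ofCoords q p u ≠ 0 := fun h ↦ hu <| by
  rw [← coords_ofCoords hp u, h, map_zero]

/-- The bridge between `coords` and the trivializations of the tangent bundle, through which smooth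
sections acquire smooth components. -/
theorem coords_eq_trivializationAt {q p : P} (hp : p ∈ (extChartAt (𝓡 n) q).source)
    (u : TangentSpace (𝓡 n) p) : coords q p u =
      (trivializationAt (EuclideanSpace ℝ (Fin n)) (TangentSpace (𝓡 n)) q ⟨p, u⟩).2 := by
  have hp' : p ∈ (chartAt (EuclideanSpace ℝ (Fin n)) q).source := by
    rwa [extChartAt_source] at hp
  have hb : p ∈ (trivializationAt (EuclideanSpace ℝ (Fin n))
      (TangentSpace (𝓡 n) : P → Type _) q).baseSet := by
    rwa [TangentBundle.trivializationAt_baseSet]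
  rw [coords, ← TangentBundle.continuousLinearMapAt_trivializationAt hp']
  exact Trivialization.continuousLinearMapAt_apply_of_mem (R := ℝ) _ hb u

/-- A vector field is smooth on a chart domain iff its components are. -/
theorem contMDiffOn_section_iff_coords {q : P} {σ : ∀ p : P, TangentSpace (𝓡 n) p} :
    ContMDiffOn (𝓡 n) ((𝓡 n).prod 𝓘(ℝ, EuclideanSpace ℝ (Fin n))) ∞
      (fun p ↦ TotalSpace.mk' (EuclideanSpace ℝ (Fin n)) p (σ p)) (extChartAt (𝓡 n) q).source ↔
    ContMDiffOn (𝓡 n) 𝓘(ℝ, EuclideanSpace ℝ (Fin n)) ∞ (fun p ↦ coords q p (σ p))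
      (extChartAt (𝓡 n) q).source := by
  rw [Trivialization.contMDiffOn_section_iff
    (trivializationAt (EuclideanSpace ℝ (Fin n)) (TangentSpace (𝓡 n)) q)
    (isOpen_extChartAt_source q)]
  · exact contMDiffOn_congr fun p hp ↦ (coords_eq_trivializationAt hp (σ p)).symm
  · rw [TangentBundle.trivializationAt_baseSet, extChartAt_source]

/-- The coordinate vector fields are smooth. -/
theorem contMDiffOn_ofCoords (q : P) (u : EuclideanSpace ℝ (Fin n)) :
    ContMDiffOn (𝓡 n) ((𝓡 n).prod 𝓘(ℝ, EuclideanSpace ℝ (Fin n))) ∞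
      (fun p ↦ TotalSpace.mk' (EuclideanSpace ℝ (Fin n)) p (ofCoords q p u))
      (extChartAt (𝓡 n) q).source := by
  rw [contMDiffOn_section_iff_coords]
  exact (contMDiffOn_const (c := u)).congr fun p hp ↦ coords_ofCoords hp u

theorem contDiffOn_comp_extChartAt_symm {F : Type*} [NormedAddCommGroup F] [NormedSpace ℝ F]
    {q : P} {h : P → F} (hh : ContMDiffOn (𝓡 n) 𝓘(ℝ, F) ∞ h (extChartAt (𝓡 n) q).source) :
    ContDiffOn ℝ ∞ (fun y ↦ h ((extChartAt (𝓡 n) q).symm y)) (extChartAt (𝓡 n) q).target := by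
  rw [← contMDiffOn_iff_contDiffOn]
  exact hh.comp (contMDiffOn_extChartAt_symm q) (extChartAt (𝓡 n) q).mapsTo_symm

theorem contDiffOn_localField {q : P} {σ : ∀ p : P, TangentSpace (𝓡 n) p}
    (hσ : ContMDiffOn (𝓡 n) ((𝓡 n).prod 𝓘(ℝ, EuclideanSpace ℝ (Fin n))) ∞
      (fun p ↦ TotalSpace.mk' (EuclideanSpace ℝ (Fin n)) p (σ p)) (extChartAt (𝓡 n) q).source) :
    ContDiffOn ℝ ∞ (localField σ q) (extChartAt (𝓡 n) q).target :=
  contDiffOn_comp_extChartAt_symm (contMDiffOn_section_iff_coords.1 hσ)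

theorem contDiffOn_localEndo {φ : ∀ p : P, TangentSpace (𝓡 n) p →L[ℝ] TangentSpace (𝓡 n) p}
    (hφ : ContMDiff (𝓡 n)
      ((𝓡 n).prod 𝓘(ℝ, EuclideanSpace ℝ (Fin n) →L[ℝ] EuclideanSpace ℝ (Fin n))) ∞
      (fun p ↦ TotalSpace.mk' (EuclideanSpace ℝ (Fin n) →L[ℝ] EuclideanSpace ℝ (Fin n))
      (E := fun p : P ↦ TangentSpace (𝓡 n) p →L[ℝ] TangentSpace (𝓡 n) p) p (φ p))) (q : P) :
    ContDiffOn ℝ ∞ (localEndo φ q) (extChartAt (𝓡 n) q).target := by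
  refine contDiffOn_clm_apply.2 fun u ↦ ?_
  exact contDiffOn_localField (hφ.contMDiffOn.clm_bundle_apply (contMDiffOn_ofCoords q u))

theorem contDiffOn_localMetric (g : ContMDiffRiemannianMetric (𝓡 n) ∞ (EuclideanSpace ℝ (Fin n))
      (fun p : P ↦ TangentSpace (𝓡 n) p)) (q : P) :
    ContDiffOn ℝ ∞ (localMetric g q) (extChartAt (𝓡 n) q).target := by
  refine contDiffOn_clm_apply.2 fun u ↦ contDiffOn_clm_apply.2 fun v ↦ ?_
  have h1 : ContMDiffOn (𝓡 n) ((𝓡 n).prod 𝓘(ℝ, ℝ)) ∞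
      (fun p ↦ TotalSpace.mk' ℝ (E := Bundle.Trivial P ℝ) p
        (g.inner p (ofCoords q p u) (ofCoords q p v))) (extChartAt (𝓡 n) q).source :=
    ContMDiffOn.clm_bundle_apply₂ (F₁ := EuclideanSpace ℝ (Fin n))
      (F₂ := EuclideanSpace ℝ (Fin n)) g.contMDiff.contMDiffOn (contMDiffOn_ofCoords q u)
      (contMDiffOn_ofCoords q v)
  have h2 : ContMDiffOn (𝓡 n) 𝓘(ℝ, ℝ) ∞
      (fun p ↦ g.inner p (ofCoords q p u) (ofCoords q p v)) (extChartAt (𝓡 n) q).source := by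
    intro p hp
    have := h1 p hp
    simp only [contMDiffWithinAt_totalSpace] at this
    exact this.2
  exact contDiffOn_comp_extChartAt_symm h2

theorem localMetric_apply (g : ContMDiffRiemannianMetric (𝓡 n) ∞ (EuclideanSpace ℝ (Fin n))
      (fun p : P ↦ TangentSpace (𝓡 n) p)) (q : P) (y u v : EuclideanSpace ℝ (Fin n)) :
    localMetric g q y u v = g.inner ((extChartAt (𝓡 n) q).symm y)
      (ofCoords q _ u) (ofCoords q _ v) := rfl

theorem isMetricOn_localMetric (g : ContMDiffRiemannianMetric (𝓡 n) ∞ (EuclideanSpace ℝ (Fin n))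
      (fun p : P ↦ TangentSpace (𝓡 n) p)) (q : P) :
    IsMetricOn (localMetric g q) (extChartAt (𝓡 n) q).target where
  isOpen := isOpen_extChartAt_target q
  contDiffOn := contDiffOn_localMetric g q
  symm y _ u v := g.symm _ _ _
  isInvertible y hy := by
    refine isInvertible_of_nondegenerate fun u hu ↦ ?_
    have hp := (extChartAt (𝓡 n) q).map_target hy
    by_contra h0
    exact (g.pos _ _ (ofCoords_ne_zero hp h0)).ne' (hu u)

theorem SasakianStructure.isSasakianOn (S : SasakianStructure n P) (q : P) :
    IsSasakianOn (localMetric S.metric q) (localEndo S.phi q) (localField S.xi q)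
      (extChartAt (𝓡 n) q).target := by
  have hξ : ∀ y ∈ (extChartAt (𝓡 n) q).target, ofCoords q ((extChartAt (𝓡 n) q).symm y)
      (localField S.xi q y) = S.xi _ := fun y hy ↦
    ofCoords_coords ((extChartAt (𝓡 n) q).map_target hy) _
  have hφ : ∀ y ∈ (extChartAt (𝓡 n) q).target, ∀ u, ofCoords q ((extChartAt (𝓡 n) q).symm y)
      (localEndo S.phi q y u) = S.phi _ (ofCoords q _ u) := fun y hy u ↦
    ofCoords_coords ((extChartAt (𝓡 n) q).map_target hy) _
  have hφ' : ∀ y u, localEndo S.phi q y u = coords q _ (S.phi _ (ofCoords q _ u)) :=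
    fun _ _ ↦ rfl
  refine ⟨isMetricOn_localMetric S.metric q, fun y hy u hu ↦ ?_, contDiffOn_localEndo S.smooth_phi q,
    contDiffOn_localField S.smooth_xi.contMDiffOn, fun y hy u ↦ ?_, fun y hy ↦ ?_, fun y hy ↦ ?_,
    fun y hy u v ↦ ?_, S.sasakian q⟩
  · exact S.metric.pos _ _ (ofCoords_ne_zero ((extChartAt (𝓡 n) q).map_target hy) hu)
  · rw [hφ', hφ y hy, S.phi_phi, map_add, map_neg, map_smul,
      coords_ofCoords ((extChartAt (𝓡 n) q).map_target hy), localMetric_apply, hξ y hy]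
    rfl
  · rw [localMetric_apply, hξ y hy, S.eta_xi]
  · rw [hφ', hξ y hy, S.phi_xi, map_zero]
  · simp only [localMetric_apply, hφ y hy, hξ y hy, S.metric_phi]

end Charts

section ChartValues

variable {n : ℕ} {P : Type*} [TopologicalSpace P] [ChartedSpace (EuclideanSpace ℝ (Fin n)) P]
  [IsManifold (𝓡 n) ∞ P] {q p : P} (hp : p ∈ (extChartAt (𝓡 n) q).source)
include hp

theorem localMetric_coords (g : ContMDiffRiemannianMetric (𝓡 n) ∞ (EuclideanSpace ℝ (Fin n))
      (fun p : P ↦ TangentSpace (𝓡 n) p)) (u v : TangentSpace (𝓡 n) p) :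
    localMetric g q (extChartAt (𝓡 n) q p) (coords q p u) (coords q p v) = g.inner p u v := by
  obtain ⟨y, hy, rfl⟩ : ∃ y ∈ (extChartAt (𝓡 n) q).target, (extChartAt (𝓡 n) q).symm y = p :=
    ⟨_, (extChartAt (𝓡 n) q).map_source hp, (extChartAt (𝓡 n) q).left_inv hp⟩
  rw [(extChartAt (𝓡 n) q).right_inv hy, localMetric_apply, ofCoords_coords hp, ofCoords_coords hp]

theorem localEndo_coords (φ : ∀ p : P, TangentSpace (𝓡 n) p →L[ℝ] TangentSpace (𝓡 n) p)
    (u : TangentSpace (𝓡 n) p) :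
    localEndo φ q (extChartAt (𝓡 n) q p) (coords q p u) = coords q p (φ p u) := by
  obtain ⟨y, hy, rfl⟩ : ∃ y ∈ (extChartAt (𝓡 n) q).target, (extChartAt (𝓡 n) q).symm y = p :=
    ⟨_, (extChartAt (𝓡 n) q).map_source hp, (extChartAt (𝓡 n) q).left_inv hp⟩
  rw [(extChartAt (𝓡 n) q).right_inv hy]
  simp only [localEndo, ContinuousLinearMap.comp_apply, ofCoords_coords hp]

omit [IsManifold (𝓡 n) ∞ P] in
theorem localField_extChartAt (ξ : ∀ p : P, TangentSpace (𝓡 n) p) :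
    localField ξ q (extChartAt (𝓡 n) q p) = coords q p (ξ p) := by
  obtain ⟨y, hy, rfl⟩ : ∃ y ∈ (extChartAt (𝓡 n) q).target, (extChartAt (𝓡 n) q).symm y = p :=
    ⟨_, (extChartAt (𝓡 n) q).map_source hp, (extChartAt (𝓡 n) q).left_inv hp⟩
  rw [(extChartAt (𝓡 n) q).right_inv hy, localField]

theorem hasMFDerivAt_extChartAt_coords :
    HasMFDerivAt (𝓡 n) 𝓘(ℝ, EuclideanSpace ℝ (Fin n)) (extChartAt (𝓡 n) q) p (coords q p) :=
  (mdifferentiableAt_extChartAt (by rwa [extChartAt_source] at hp)).hasMFDerivAt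

/-- Differentiating a function through a chart. -/
theorem fderiv_apply_coords {F : Type*} [NormedAddCommGroup F] [NormedSpace ℝ F]
    {h : EuclideanSpace ℝ (Fin n) → F} (hh : DifferentiableAt ℝ h (extChartAt (𝓡 n) q p))
    {h' : P → F} (he : h ∘ extChartAt (𝓡 n) q =ᶠ[𝓝 p] h') (u : TangentSpace (𝓡 n) p) :
    fderiv ℝ h (extChartAt (𝓡 n) q p) (coords q p u) = mfderiv (𝓡 n) 𝓘(ℝ, F) h' p u := by
  have h1 : HasMFDerivAt 𝓘(ℝ, EuclideanSpace ℝ (Fin n)) 𝓘(ℝ, F) h (extChartAt (𝓡 n) q p)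
      (fderiv ℝ h (extChartAt (𝓡 n) q p)) := hh.hasFDerivAt.hasMFDerivAt
  have h2 := (h1.comp p (hasMFDerivAt_extChartAt_coords hp)).congr_of_eventuallyEq he.symm
  rw [h2.mfderiv]
  rfl

theorem contMDiffAt_extChartAt_symm : ContMDiffAt 𝓘(ℝ, EuclideanSpace ℝ (Fin n)) (𝓡 n) ∞
    (extChartAt (𝓡 n) q).symm (extChartAt (𝓡 n) q p) :=
  (contMDiffOn_extChartAt_symm q).contMDiffAt
    ((isOpen_extChartAt_target q).mem_nhds ((extChartAt (𝓡 n) q).map_source hp))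

end ChartValues

section Transition

variable {n : ℕ} {P : Type*} [TopologicalSpace P] [ChartedSpace (EuclideanSpace ℝ (Fin n)) P]
  [IsManifold (𝓡 n) ∞ P] {q q' p : P} (hp : p ∈ (extChartAt (𝓡 n) q).source)
  (hp' : p ∈ (extChartAt (𝓡 n) q').source)
include hp hp'

theorem contDiffAt_transition :
    ContDiffAt ℝ ∞ (extChartAt (𝓡 n) q' ∘ (extChartAt (𝓡 n) q).symm) (extChartAt (𝓡 n) q p) := by
  rw [← contMDiffAt_iff_contDiffAt]
  have h1 : ContMDiffAt (𝓡 n) 𝓘(ℝ, EuclideanSpace ℝ (Fin n)) ∞ (extChartAt (𝓡 n) q')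
      ((extChartAt (𝓡 n) q).symm (extChartAt (𝓡 n) q p)) := by
    rw [(extChartAt (𝓡 n) q).left_inv hp]
    exact contMDiffAt_extChartAt' (by rwa [extChartAt_source] at hp')
  exact h1.comp _ (contMDiffAt_extChartAt_symm hp)

theorem fderiv_transition (u : TangentSpace (𝓡 n) p) :
    fderiv ℝ (extChartAt (𝓡 n) q' ∘ (extChartAt (𝓡 n) q).symm) (extChartAt (𝓡 n) q p)
      (coords q p u) = coords q' p u := by
  refine fderiv_apply_coords hp ((contDiffAt_transition hp hp').differentiableAt (by simp)) ?_ u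
  filter_upwards [(isOpen_extChartAt_source q).mem_nhds hp] with z hz
  simp only [Function.comp_apply, (extChartAt (𝓡 n) q).left_inv hz]

theorem isInvertible_fderiv_transition :
    (fderiv ℝ (extChartAt (𝓡 n) q' ∘ (extChartAt (𝓡 n) q).symm)
      (extChartAt (𝓡 n) q p)).IsInvertible := by
  obtain ⟨e, he⟩ := isInvertible_coords hp
  obtain ⟨e', he'⟩ := isInvertible_coords hp'
  refine ⟨e.symm.trans e', ?_⟩
  ext1 w
  have h1 := fderiv_transition hp hp' (e.symm w)
  have h2 : coords q p (e.symm w) = w := by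
    rw [← he]
    exact e.apply_symm_apply w
  rw [h2] at h1
  rw [h1, ← he']
  rfl

/-- Coordinate changes are local isometries between the chart metrics, as the chart independence of
the second fundamental form demands. -/
theorem pullbackForm_transition (g : ContMDiffRiemannianMetric (𝓡 n) ∞ (EuclideanSpace ℝ (Fin n))
      (fun p : P ↦ TangentSpace (𝓡 n) p)) :
    pullbackForm (localMetric g q') (extChartAt (𝓡 n) q' ∘ (extChartAt (𝓡 n) q).symm)
      =ᶠ[𝓝 (extChartAt (𝓡 n) q p)] localMetric g q := by
  have h1 : ∀ᶠ y in 𝓝 (extChartAt (𝓡 n) q p), (extChartAt (𝓡 n) q).symm y ∈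
      (extChartAt (𝓡 n) q').source := by
    refine (contMDiffAt_extChartAt_symm hp).continuousAt.eventually_mem
      ((isOpen_extChartAt_source q').mem_nhds ?_)
    rwa [(extChartAt (𝓡 n) q).left_inv hp]
  filter_upwards [h1, (isOpen_extChartAt_target q).mem_nhds
    ((extChartAt (𝓡 n) q).map_source hp)] with y hy1 hy
  have hy2 := (extChartAt (𝓡 n) q).map_target hy
  ext u v
  obtain ⟨u, rfl⟩ := (isInvertible_coords hy2).surjective u
  obtain ⟨v, rfl⟩ := (isInvertible_coords hy2).surjective v
  have hd := fderiv_transition hy2 hy1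
  have hm := localMetric_coords hy2 g
  rw [(extChartAt (𝓡 n) q).right_inv hy] at hd hm
  rw [hm, pullbackForm, pullForm_apply, hd, hd]
  exact localMetric_coords hy1 g u v

end Transition

/-! ### Immersions and their mean curvature vector in charts. -/

section Maps

variable {k n : ℕ}
  {M : Type*} [TopologicalSpace M] [ChartedSpace (EuclideanSpace ℝ (Fin k)) M]
  [IsManifold (𝓡 k) ∞ M]
  {P : Type*} [TopologicalSpace P] [ChartedSpace (EuclideanSpace ℝ (Fin n)) P]
  [IsManifold (𝓡 n) ∞ P]
  {ψ : M → P} (hψ : IsSmoothImmersion (k := k) (n := n) ψ)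

/-- The domain of a map in charts. -/
def localDomain (k n : ℕ) {M : Type*} [TopologicalSpace M]
    [ChartedSpace (EuclideanSpace ℝ (Fin k)) M] {P : Type*} [TopologicalSpace P]
    [ChartedSpace (EuclideanSpace ℝ (Fin n)) P] (ψ : M → P) (p₀ : M) :
    Set (EuclideanSpace ℝ (Fin k)) :=
  (extChartAt (𝓡 k) p₀).target ∩
    (extChartAt (𝓡 k) p₀).symm ⁻¹' (ψ ⁻¹' (extChartAt (𝓡 n) (ψ p₀)).source)

omit [IsManifold (𝓡 k) ∞ M] [IsManifold (𝓡 n) ∞ P] in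
theorem extChartAt_mem_localDomain_self (ψ : M → P) (p₀ : M) :
    extChartAt (𝓡 k) p₀ p₀ ∈ localDomain k n ψ p₀ := by
  refine ⟨mem_extChartAt_target p₀, ?_⟩
  simp

omit [IsManifold (𝓡 k) ∞ M] [IsManifold (𝓡 n) ∞ P] in
theorem exists_of_mem_localDomain {ψ : M → P} {p₀ : M} {x : EuclideanSpace ℝ (Fin k)}
    (hx : x ∈ localDomain k n ψ p₀) : ∃ p, p ∈ (extChartAt (𝓡 k) p₀).source ∧
      ψ p ∈ (extChartAt (𝓡 n) (ψ p₀)).source ∧ extChartAt (𝓡 k) p₀ p = x :=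
  ⟨(extChartAt (𝓡 k) p₀).symm x, (extChartAt (𝓡 k) p₀).map_target hx.1, hx.2,
    (extChartAt (𝓡 k) p₀).right_inv hx.1⟩

include hψ

omit [IsManifold (𝓡 k) ∞ M] [IsManifold (𝓡 n) ∞ P] in
theorem IsSmoothImmersion.isOpen_localDomain (p₀ : M) : IsOpen (localDomain k n ψ p₀) :=
  (continuousOn_extChartAt_symm p₀).isOpen_inter_preimage (isOpen_extChartAt_target p₀)
    ((isOpen_extChartAt_source (ψ p₀)).preimage hψ.1.continuous)

theorem IsSmoothImmersion.contDiffOn_localMap (p₀ : M) :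
    ContDiffOn ℝ ∞ (localMap (k := k) (n := n) ψ p₀) (localDomain k n ψ p₀) := by
  rw [← contMDiffOn_iff_contDiffOn]
  have h1 : ContMDiffOn 𝓘(ℝ, EuclideanSpace ℝ (Fin k)) (𝓡 n) ∞
      (fun x ↦ ψ ((extChartAt (𝓡 k) p₀).symm x)) (localDomain k n ψ p₀) :=
    hψ.1.comp_contMDiffOn ((contMDiffOn_extChartAt_symm p₀).mono Set.inter_subset_left)
  have h2 : ContMDiffOn (𝓡 n) 𝓘(ℝ, EuclideanSpace ℝ (Fin n)) ∞ (extChartAt (𝓡 n) (ψ p₀))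
      (extChartAt (𝓡 n) (ψ p₀)).source := by
    rw [extChartAt_source]
    exact contMDiffOn_extChartAt
  exact h2.comp h1 fun x hx ↦ hx.2

omit [IsManifold (𝓡 k) ∞ M] [IsManifold (𝓡 n) ∞ P] hψ in
theorem mapsTo_localMap (ψ : M → P) (p₀ : M) :
    Set.MapsTo (localMap (k := k) (n := n) ψ p₀) (localDomain k n ψ p₀)
      (extChartAt (𝓡 n) (ψ p₀)).target :=
  fun _ hx ↦ (extChartAt (𝓡 n) (ψ p₀)).map_source hx.2

variable {p₀ p : M} (hp : p ∈ (extChartAt (𝓡 k) p₀).source)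
  (hψp : ψ p ∈ (extChartAt (𝓡 n) (ψ p₀)).source)
include hp

omit [IsManifold (𝓡 k) ∞ M] [IsManifold (𝓡 n) ∞ P] hψ in
theorem localMap_extChartAt : localMap (k := k) (n := n) ψ p₀ (extChartAt (𝓡 k) p₀ p) =
    extChartAt (𝓡 n) (ψ p₀) (ψ p) := by
  rw [localMap, (extChartAt (𝓡 k) p₀).left_inv hp]

omit [IsManifold (𝓡 k) ∞ M] [IsManifold (𝓡 n) ∞ P] hψ in
theorem localAlong_extChartAt (s : ∀ p : M, TangentSpace (𝓡 n) (ψ p)) :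
    localAlong ψ s p₀ (extChartAt (𝓡 k) p₀ p) = coords (ψ p₀) (ψ p) (s p) := by
  obtain ⟨y, hy, rfl⟩ : ∃ y ∈ (extChartAt (𝓡 k) p₀).target, (extChartAt (𝓡 k) p₀).symm y = p :=
    ⟨_, (extChartAt (𝓡 k) p₀).map_source hp, (extChartAt (𝓡 k) p₀).left_inv hp⟩
  rw [(extChartAt (𝓡 k) p₀).right_inv hy, localAlong]

include hψp

omit [IsManifold (𝓡 k) ∞ M] [IsManifold (𝓡 n) ∞ P] hψ in
theorem extChartAt_mem_localDomain : extChartAt (𝓡 k) p₀ p ∈ localDomain k n ψ p₀ := by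
  refine ⟨(extChartAt (𝓡 k) p₀).map_source hp, ?_⟩
  simpa only [Set.mem_preimage, (extChartAt (𝓡 k) p₀).left_inv hp] using hψp

/-- The differential of an immersion in charts. -/
theorem IsSmoothImmersion.fderiv_localMap (u : TangentSpace (𝓡 k) p) :
    fderiv ℝ (localMap (k := k) (n := n) ψ p₀) (extChartAt (𝓡 k) p₀ p) (coords p₀ p u) =
      coords (ψ p₀) (ψ p) (mfderiv (𝓡 k) (𝓡 n) ψ p u) := by
  have hx := extChartAt_mem_localDomain hp hψp
  have hd : DifferentiableAt ℝ (localMap (k := k) (n := n) ψ p₀) (extChartAt (𝓡 k) p₀ p) :=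
    ((hψ.contDiffOn_localMap p₀).contDiffAt
      ((hψ.isOpen_localDomain p₀).mem_nhds hx)).differentiableAt (by simp)
  have h1 : HasMFDerivAt (𝓡 k) 𝓘(ℝ, EuclideanSpace ℝ (Fin n))
      (extChartAt (𝓡 n) (ψ p₀) ∘ ψ) p _ :=
    (hasMFDerivAt_extChartAt_coords hψp).comp p
      (hψ.1.contMDiffAt.mdifferentiableAt (by simp)).hasMFDerivAt
  rw [fderiv_apply_coords (h' := extChartAt (𝓡 n) (ψ p₀) ∘ ψ) hp hd, h1.mfderiv]
  · rfl
  · filter_upwards [(isOpen_extChartAt_source p₀).mem_nhds hp] with z hz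
    exact localMap_extChartAt hz

theorem IsSmoothImmersion.injective_fderiv_localMap :
    Function.Injective
      (fderiv ℝ (localMap (k := k) (n := n) ψ p₀) (extChartAt (𝓡 k) p₀ p)) := by
  intro u v huv
  obtain ⟨u, rfl⟩ := (isInvertible_coords hp).surjective u
  obtain ⟨v, rfl⟩ := (isInvertible_coords hp).surjective v
  rw [hψ.fderiv_localMap hp hψp, hψ.fderiv_localMap hp hψp] at huv
  rw [hψ.2 p ((isInvertible_coords hψp).injective huv)]

variable (g : ContMDiffRiemannianMetric (𝓡 n) ∞ (EuclideanSpace ℝ (Fin n))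
      (fun p : P ↦ TangentSpace (𝓡 n) p))

theorem IsSmoothImmersion.pullbackForm_localMap (u v : TangentSpace (𝓡 k) p) :
    pullbackForm (localMetric g (ψ p₀)) (localMap (k := k) ψ p₀) (extChartAt (𝓡 k) p₀ p)
      (coords p₀ p u) (coords p₀ p v) = inducedMetric (k := k) g ψ p u v := by
  rw [pullbackForm, pullForm_apply, hψ.fderiv_localMap hp hψp, hψ.fderiv_localMap hp hψp,
    localMap_extChartAt hp, localMetric_coords hψp]
  rfl

omit hp hψp

theorem IsSmoothImmersion.isMetricOn_pullbackForm (p₀ : M) :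
    IsMetricOn (pullbackForm (localMetric g (ψ p₀)) (localMap (k := k) ψ p₀))
      (localDomain k n ψ p₀) := by
  refine (isMetricOn_localMetric g (ψ p₀)).pullbackForm (hψ.isOpen_localDomain p₀)
    (hψ.contDiffOn_localMap p₀) (mapsTo_localMap ψ p₀) fun x hx u hu ↦ ?_
  obtain ⟨p, hp, hψp, rfl⟩ := exists_of_mem_localDomain hx
  obtain ⟨u, rfl⟩ := (isInvertible_coords hp).surjective u
  have h1 := hu (coords p₀ p u)
  rw [hψ.fderiv_localMap hp hψp, localMap_extChartAt hp, localMetric_coords hψp] at h1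
  have h2 : mfderiv (𝓡 k) (𝓡 n) ψ p u = 0 := by
    by_contra h0
    exact (g.pos _ _ h0).ne' h1
  have h3 : u = 0 := hψ.2 p (h2.trans (map_zero _).symm)
  rw [h3, map_zero]

omit [IsManifold (𝓡 k) ∞ M] in
theorem IsSmoothImmersion.isInvertible_inducedMetric (p : M) :
    (inducedMetric (k := k) g ψ p).IsInvertible := by
  refine isInvertible_of_nondegenerate fun u hu ↦ ?_
  have h2 : mfderiv (𝓡 k) (𝓡 n) ψ p u = 0 := by
    by_contra h0
    exact (g.pos _ _ h0).ne' (hu u)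
  exact hψ.2 p (h2.trans (map_zero _).symm)

include hp hψp

/-- The second fundamental form in a fixed chart. -/
theorem IsSmoothImmersion.coords_secondForm (u v : TangentSpace (𝓡 k) p) :
    coords (ψ p₀) (ψ p) (secondForm g ψ p u v) =
      localSecondForm (localMetric g (ψ p₀)) (localMap (k := k) ψ p₀) (extChartAt (𝓡 k) p₀ p)
        (coords p₀ p u) (coords p₀ p v) := by
  have hx := extChartAt_mem_localDomain hp hψp
  have hpp := mem_extChartAt_source (I := 𝓡 k) p
  have hψpp := mem_extChartAt_source (I := 𝓡 n) (ψ p)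
  have hfx := localMap_extChartAt (k := k) (n := n) (ψ := ψ) hp
  have hat : ∀ p₀ : M, ∀ x ∈ localDomain k n ψ p₀,
      ContDiffAt ℝ ∞ (localMap (k := k) (n := n) ψ p₀) x := fun p₀ x hx ↦
    (hψ.contDiffOn_localMap p₀).contDiffAt ((hψ.isOpen_localDomain p₀).mem_nhds hx)
  have hχx : (extChartAt (𝓡 k) p ∘ (extChartAt (𝓡 k) p₀).symm) (extChartAt (𝓡 k) p₀ p) =
      extChartAt (𝓡 k) p p := by
    simp only [Function.comp_apply, (extChartAt (𝓡 k) p₀).left_inv hp]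
  have hκx : (extChartAt (𝓡 n) (ψ p) ∘ (extChartAt (𝓡 n) (ψ p₀)).symm)
      (localMap (k := k) ψ p₀ (extChartAt (𝓡 k) p₀ p)) = extChartAt (𝓡 n) (ψ p) (ψ p) := by
    simp only [hfx, Function.comp_apply, (extChartAt (𝓡 n) (ψ p₀)).left_inv hψp]
  -- `secondForm` at p refers to the charts centred at p and ψ p, while derivatives near p₀ need one
  -- fixed pair of charts.
  have key := localSecondForm_coordChange (isMetricOn_localMetric g (ψ p₀))
    (hψ.isMetricOn_pullbackForm g p₀) hx (isMetricOn_localMetric g (ψ p))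
    (hψ.isMetricOn_pullbackForm g p) (mapsTo_localMap ψ p₀ hx)
    (χ := extChartAt (𝓡 k) p ∘ (extChartAt (𝓡 k) p₀).symm)
    (κ := extChartAt (𝓡 n) (ψ p) ∘ (extChartAt (𝓡 n) (ψ p₀)).symm)
    (by rw [hκx]; exact mem_extChartAt_target (ψ p))
    (by rw [hχx]; exact extChartAt_mem_localDomain_self ψ p) (hat p₀ _ hx)
    (by rw [hχx]; exact hat p _ (extChartAt_mem_localDomain_self ψ p))
    (contDiffAt_transition hp hpp) (by rw [hfx]; exact contDiffAt_transition hψp hψpp)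
    (isInvertible_fderiv_transition hp hpp)
    (by rw [hfx]; exact isInvertible_fderiv_transition hψp hψpp)
    (by rw [hfx]; exact pullbackForm_transition hψp hψpp g)
    (by
      have h1 : ∀ᶠ z in 𝓝 (extChartAt (𝓡 k) p₀ p), (extChartAt (𝓡 k) p₀).symm z ∈
          (extChartAt (𝓡 k) p).source := by
        refine (contMDiffAt_extChartAt_symm hp).continuousAt.eventually_mem
          ((isOpen_extChartAt_source p).mem_nhds ?_)
        rwa [(extChartAt (𝓡 k) p₀).left_inv hp]
      filter_upwards [h1, (hψ.isOpen_localDomain p₀).mem_nhds hx] with z hz hz'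
      simp only [Function.comp_apply, localMap, (extChartAt (𝓡 k) p).left_inv hz,
        (extChartAt (𝓡 n) (ψ p₀)).left_inv hz'.2]) (coords p₀ p u) (coords p₀ p v)
  rw [fderiv_transition hp hpp, fderiv_transition hp hpp, hχx] at key
  obtain ⟨W, hW⟩ := (isInvertible_coords hψp).surjective
    (localSecondForm (localMetric g (ψ p₀)) (localMap (k := k) ψ p₀) (extChartAt (𝓡 k) p₀ p)
        (coords p₀ p u) (coords p₀ p v))
  rw [← hW] at key ⊢
  rw [hfx, fderiv_transition hψp hψpp] at key
  rw [secondForm, key, ofCoords_coords hψpp]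

/-- The mean curvature vector field in a fixed chart. -/
theorem IsSmoothImmersion.coords_meanCurvatureVector :
    coords (ψ p₀) (ψ p) (meanCurvatureVector (k := k) g ψ p) =
      (k : ℝ)⁻¹ • metricTrace (pullbackForm (localMetric g (ψ p₀)) (localMap (k := k) ψ p₀)
        (extChartAt (𝓡 k) p₀ p))
        (localSecondForm (localMetric g (ψ p₀)) (localMap (k := k) ψ p₀)
          (extChartAt (𝓡 k) p₀ p)) := by
  have hx := extChartAt_mem_localDomain hp hψp
  rw [meanCurvatureVector, map_smul]
  congr 1
  have h1 := map_metricTrace (coords (ψ p₀) (ψ p)).toLinearMap (inducedMetric (k := k) g ψ p)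
    (secondForm (k := k) g ψ p)
  simp only [ContinuousLinearMap.coe_coe] at h1
  rw [h1]
  simp only [hψ.coords_secondForm hp hψp g]
  exact metricTrace_pullForm ((hψ.isMetricOn_pullbackForm g p₀).isInvertible _ hx)
    (hψ.isInvertible_inducedMetric g p) (isInvertible_coords hp)
    (fun u v ↦ (hψ.pullbackForm_localMap hp hψp g u v).symm)
    (isBilinearMap_localSecondForm _
      ((hψ.contDiffOn_localMap p₀).contDiffAt ((hψ.isOpen_localDomain p₀).mem_nhds hx)))

omit hp hψp

theorem IsSmoothImmersion.contDiffOn_localAlong_meanCurvatureVector (p₀ : M) :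
    ContDiffOn ℝ ∞ (localAlong ψ (meanCurvatureVector (k := k) g ψ) p₀)
      (localDomain k n ψ p₀) := by
  refine ((contDiffOn_metricTrace_localSecondForm (isMetricOn_localMetric g (ψ p₀))
    (hψ.isMetricOn_pullbackForm g p₀) (hψ.contDiffOn_localMap p₀)
    (mapsTo_localMap ψ p₀)).const_smul (k : ℝ)⁻¹).congr fun x hx ↦ ?_
  obtain ⟨p, hp, hψp, rfl⟩ := exists_of_mem_localDomain hx
  rw [localAlong_extChartAt hp, hψ.coords_meanCurvatureVector hp hψp]

/-- The mean curvature vector is normal. -/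
theorem IsSmoothImmersion.inner_meanCurvatureVector (p : M) (u : TangentSpace (𝓡 k) p) :
    g.inner (ψ p) (meanCurvatureVector (k := k) g ψ p) (mfderiv (𝓡 k) (𝓡 n) ψ p u) = 0 := by
  have hpp := mem_extChartAt_source (I := 𝓡 k) p
  have hψpp := mem_extChartAt_source (I := 𝓡 n) (ψ p)
  have hx := extChartAt_mem_localDomain hpp hψpp
  rw [← localMetric_coords hψpp, ← hψ.fderiv_localMap hpp hψpp,
    hψ.coords_meanCurvatureVector hpp hψpp, map_smul, smul_apply,
    ← localMap_extChartAt hpp]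
  have h1 := map_metricTrace ((localMetric g (ψ p) (localMap (k := k) ψ p (extChartAt (𝓡 k) p p))
    ).flip (fderiv ℝ (localMap (k := k) ψ p) (extChartAt (𝓡 k) p p) (coords p p u))).toLinearMap
    (pullbackForm (localMetric g (ψ p)) (localMap (k := k) ψ p) (extChartAt (𝓡 k) p p))
    (localSecondForm (localMetric g (ψ p)) (localMap (k := k) ψ p) (extChartAt (𝓡 k) p p))
  simp only [ContinuousLinearMap.coe_coe, ContinuousLinearMap.flip_apply] at h1
  rw [h1]
  simp only [apply_localSecondForm (isMetricOn_localMetric g (ψ p))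
    (hψ.isMetricOn_pullbackForm g p) hx (mapsTo_localMap ψ p hx)
    ((hψ.contDiffOn_localMap p).contDiffAt ((hψ.isOpen_localDomain p).mem_nhds hx)),
    metricTrace_zero, smul_zero]

end Maps

/-! ### Critical points and locally constant functions. -/

section Functions

variable {k : ℕ} {M : Type*} [TopologicalSpace M] [ChartedSpace (EuclideanSpace ℝ (Fin k)) M]
  [IsManifold (𝓡 k) ∞ M] {h : M → ℝ}

theorem differentiableAt_comp_extChartAt_symm {q p : M} (hp : p ∈ (extChartAt (𝓡 k) q).source)
    (hh : MDifferentiableAt (𝓡 k) 𝓘(ℝ, ℝ) h p) :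
    DifferentiableAt ℝ (h ∘ (extChartAt (𝓡 k) q).symm) (extChartAt (𝓡 k) q p) := by
  rw [← mdifferentiableAt_iff_differentiableAt]
  refine MDifferentiableAt.comp _ ?_
    ((contMDiffAt_extChartAt_symm hp).mdifferentiableAt (by simp))
  rwa [(extChartAt (𝓡 k) q).left_inv hp]

theorem fderiv_comp_extChartAt_symm {q p : M} (hp : p ∈ (extChartAt (𝓡 k) q).source)
    (hh : MDifferentiableAt (𝓡 k) 𝓘(ℝ, ℝ) h p) (u : TangentSpace (𝓡 k) p) :
    fderiv ℝ (h ∘ (extChartAt (𝓡 k) q).symm) (extChartAt (𝓡 k) q p) (coords q p u) =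
      mfderiv (𝓡 k) 𝓘(ℝ, ℝ) h p u := by
  refine fderiv_apply_coords hp (differentiableAt_comp_extChartAt_symm hp hh) ?_ u
  filter_upwards [(isOpen_extChartAt_source q).mem_nhds hp] with z hz
  simp only [Function.comp_apply, (extChartAt (𝓡 k) q).left_inv hz]

theorem mfderiv_eq_zero_of_isMin {p : M} (hh : MDifferentiableAt (𝓡 k) 𝓘(ℝ, ℝ) h p)
    (hmin : ∀ q, h p ≤ h q) (u : TangentSpace (𝓡 k) p) : mfderiv (𝓡 k) 𝓘(ℝ, ℝ) h p u = 0 := by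
  have hpp := mem_extChartAt_source (I := 𝓡 k) p
  have h1 : IsLocalMin (h ∘ (extChartAt (𝓡 k) p).symm) (extChartAt (𝓡 k) p p) := by
    refine Eventually.of_forall fun z ↦ ?_
    simpa only [Function.comp_apply, (extChartAt (𝓡 k) p).left_inv hpp] using hmin _
  rw [← fderiv_comp_extChartAt_symm hpp hh, h1.fderiv_eq_zero, zero_apply]
  rfl

/-- A function with vanishing differential is locally constant. -/
theorem isLocallyConstant_of_mfderiv_eq_zero (hh : MDifferentiable (𝓡 k) 𝓘(ℝ, ℝ) h)
    (hz : ∀ (p : M) (u : TangentSpace (𝓡 k) p), mfderiv (𝓡 k) 𝓘(ℝ, ℝ) h p u = 0) :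
    IsLocallyConstant h := by
  rw [IsLocallyConstant.iff_eventually_eq]
  intro p
  have hpp := mem_extChartAt_source (I := 𝓡 k) p
  obtain ⟨r, hr, hball⟩ := Metric.isOpen_iff.1 (isOpen_extChartAt_target (I := 𝓡 k) p) _
    (mem_extChartAt_target p)
  have hd : ∀ y ∈ (extChartAt (𝓡 k) p).target,
      DifferentiableAt ℝ (h ∘ (extChartAt (𝓡 k) p).symm) y ∧
        fderiv ℝ (h ∘ (extChartAt (𝓡 k) p).symm) y = 0 := by
    intro y hy
    have hs := (extChartAt (𝓡 k) p).map_target hy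
    have h1 := differentiableAt_comp_extChartAt_symm hs (hh _)
    have h2 := fderiv_comp_extChartAt_symm hs (hh _)
    rw [(extChartAt (𝓡 k) p).right_inv hy] at h1 h2
    refine ⟨h1, ?_⟩
    ext1 u
    obtain ⟨u, rfl⟩ := (isInvertible_coords hs).surjective u
    rw [h2, hz, zero_apply]
    rfl
  have hconst : ∀ z ∈ Metric.ball (extChartAt (𝓡 k) p p) r,
      (h ∘ (extChartAt (𝓡 k) p).symm) z =
        (h ∘ (extChartAt (𝓡 k) p).symm) (extChartAt (𝓡 k) p p) := fun z hz ↦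
    Metric.isOpen_ball.is_const_of_fderiv_eq_zero (𝕜 := ℝ)
      (convex_ball _ r).isPreconnected
      (fun y hy ↦ (hd y (hball hy)).1.differentiableWithinAt)
      (fun y hy ↦ (hd y (hball hy)).2) hz (Metric.mem_ball_self hr)
  filter_upwards [(isOpen_extChartAt_source p).mem_nhds hpp,
    (contMDiffAt_extChartAt (I := 𝓡 k) (n := ∞) (x := p)).continuousAt.preimage_mem_nhds
      (Metric.ball_mem_nhds _ hr)] with z hz1 hz2
  have := hconst _ hz2
  simpa only [Function.comp_apply, (extChartAt (𝓡 k) p).left_inv hz1,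
    (extChartAt (𝓡 k) p).left_inv hpp] using this

end Functions

/-- An indefinite metric may degenerate on a submanifold. Tangency of ξ prevents this: ξ is
available as a test vector, so the nondegeneracy argument for the ambient form works on tangent
vectors. -/
theorem IsSasakianOn.isMetricOn_pullbackForm_deform {k n : ℕ} {G : FormField n}
    {φ : Euc n → Euc n →L[ℝ] Euc n} {ξ : Euc n → Euc n} {U : Set (Euc n)}
    (hS : IsSasakianOn G φ ξ U) {a b : ℝ} {Gh : FormField n} (ha : a ≠ 0) (hab : a + b ≠ 0)
    (hGh : ∀ y ∈ U, ∀ u v, Gh y u v = a * G y u v + b * G y (ξ y) u * G y (ξ y) v)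
    {f : Euc k → Euc n} {O : Set (Euc k)} (hO : IsOpen O) (hf : ContDiffOn ℝ ∞ f O)
    (hU : Set.MapsTo f O U) (hinj : ∀ x ∈ O, Function.Injective (fderiv ℝ f x))
    (hξ : ∀ x ∈ O, ∃ w, fderiv ℝ f x w = ξ (f x)) : IsMetricOn (pullbackForm Gh f) O := by
  refine (hS.isMetricOn_deform ha hab hGh).pullbackForm hO hf hU fun x hx u hu ↦ ?_
  obtain ⟨w, hw⟩ := hξ x hx
  have h1 := hu w
  rw [hw, hS.deform_xi hGh (hU hx)] at h1
  have h2 := (mul_eq_zero.1 h1).resolve_left hab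
  have h3 := hu u
  rw [hGh _ (hU hx), h2, mul_zero, add_zero] at h3
  have h4 : fderiv ℝ f x u = 0 := by
    by_contra h0
    exact (hS.pos _ (hU hx) _ h0).ne' ((mul_eq_zero.1 h3).resolve_left ha)
  exact hinj x hx (h4.trans (map_zero _).symm)

/-! ### From the chart computation to the hypersurface. -/

section Hypersurface

variable {m : ℕ}
    {P : Type*} [TopologicalSpace P] [ChartedSpace (EuclideanSpace ℝ (Fin (2 * m + 1))) P]
    [IsManifold (𝓡 (2 * m + 1)) ∞ P]
    {M : Type*} [TopologicalSpace M] [ChartedSpace (EuclideanSpace ℝ (Fin (2 * m))) M]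
    [IsManifold (𝓡 (2 * m)) ∞ M]
    {S : SasakianStructure (2 * m + 1) P} {c : ℝ}
    {ψ : M → P}

/-- The mean curvature of a Ricci-biharmonic hypersurface tangent to `ξ` is stationary in the
direction of `φ H`. -/
theorem exists_mfderiv_meanCurvature_eq_zero (hc : S.IsSpaceForm c)
    (hRic : RicciIsMetric S.metric) (hψ : IsSmoothImmersion (k := 2 * m) (n := 2 * m + 1) ψ)
    (hξ : XiTangent (k := 2 * m) ψ S) (hbi : IsRicciBiharmonic (k := 2 * m) S.metric ψ)
    (hdiff : MDifferentiable (𝓡 (2 * m)) 𝓘(ℝ, ℝ) (meanCurvature (k := 2 * m) S.metric ψ))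
    (p : M) (hp : meanCurvatureVector (k := 2 * m) S.metric ψ p ≠ 0) :
    ∃ w : TangentSpace (𝓡 (2 * m)) p, mfderiv (𝓡 (2 * m)) (𝓡 (2 * m + 1)) ψ p w =
      S.phi (ψ p) (meanCurvatureVector (k := 2 * m) S.metric ψ p) ∧
      mfderiv (𝓡 (2 * m)) 𝓘(ℝ, ℝ) (meanCurvature (k := 2 * m) S.metric ψ) p w = 0 := by
  have hpp := mem_extChartAt_source (I := 𝓡 (2 * m)) p
  have hψpp := mem_extChartAt_source (I := 𝓡 (2 * m + 1)) (ψ p)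
  have hS := S.isSasakianOn (ψ p)
  set U := (extChartAt (𝓡 (2 * m + 1)) (ψ p)).target with hUdef
  set G := localMetric S.metric (ψ p) with hG
  set f := localMap (k := 2 * m) (n := 2 * m + 1) ψ p with hfdef
  set s := localAlong (k := 2 * m) (n := 2 * m + 1) ψ (meanCurvatureVector (k := 2 * m) S.metric ψ) p with hsdef
  set O := localDomain (2 * m) (2 * m + 1) ψ p with hOdef
  set x := extChartAt (𝓡 (2 * m)) p p with hxdef
  have hx : x ∈ O := extChartAt_mem_localDomain hpp hψpp
  have hO : IsOpen O := hψ.isOpen_localDomain p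
  have hU : Set.MapsTo f O U := mapsTo_localMap ψ p
  have hf : ContDiffOn ℝ ∞ f O := hψ.contDiffOn_localMap p
  have hs : ContDiffOn ℝ ∞ s O := hψ.contDiffOn_localAlong_meanCurvatureVector S.metric p
  have hfx := hU hx
  -- pointwise data in the chart
  have hinj : ∀ z ∈ O, Function.Injective (fderiv ℝ f z) := by
    intro z hz
    obtain ⟨q, hq, hψq, rfl⟩ := exists_of_mem_localDomain hz
    exact hψ.injective_fderiv_localMap hq hψq
  have hfξ : ∀ z ∈ O, ∃ w, fderiv ℝ f z w = localField S.xi (ψ p) (f z) := by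
    intro z hz
    obtain ⟨q, hq, hψq, rfl⟩ := exists_of_mem_localDomain hz
    obtain ⟨u, hu⟩ := hξ q
    refine ⟨coords p q u, ?_⟩
    rw [hψ.fderiv_localMap hq hψq, hu, hfdef, localMap_extChartAt hq, localField_extChartAt hψq]
  have hsn : ∀ z ∈ O, ∀ u, G (f z) (s z) (fderiv ℝ f z u) = 0 := by
    intro z hz u
    obtain ⟨q, hq, hψq, rfl⟩ := exists_of_mem_localDomain hz
    obtain ⟨u, rfl⟩ := (isInvertible_coords hq).surjective u
    rw [hψ.fderiv_localMap hq hψq, hfdef, hsdef, localMap_extChartAt hq, localAlong_extChartAt hq,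
      localMetric_coords hψq, hψ.inner_meanCurvatureVector]
  have hsξ : ∀ z ∈ O, G (f z) (localField S.xi (ψ p) (f z)) (s z) = 0 := by
    intro z hz
    obtain ⟨w, hw⟩ := hfξ z hz
    rw [← hw, hS.symm (hU hz), hsn z hz]
  have hsx : s x ≠ 0 := by
    rw [hsdef, hxdef, localAlong_extChartAt hpp]
    intro h0
    exact hp ((isInvertible_coords hψpp).injective (h0.trans (map_zero _).symm))
  -- the Ricci tensor
  have hGh : ∀ y ∈ U, ∀ u v, ricci G y u v = ((c - 1) / 2 + m * (c + 3) / 2) * G y u v +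
      (-(m + 1) * (c - 1) / 2) * G y (localField S.xi (ψ p) y) u *
        G y (localField S.xi (ψ p) y) v := fun y hy u v ↦
    hS.ricci_eq hy (hc (ψ p) y hy) u v
  -- If a vanished, Ric would reduce to b η⊗η, and the nonzero vector H, with η(H) = 0, would lie in
  -- its kernel.
  have ha : (c - 1) / 2 + m * (c + 3) / 2 ≠ 0 := by
    intro ha
    refine hsx (hRic (ψ p) (f x) hfx (s x) fun v ↦ ?_)
    rw [hGh _ hfx, ha, hsξ x hx]
    ring
  -- For m = 0 the hypersurface has no nonzero tangent vector, yet ξ ≠ 0 is tangent.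
  have hm : (m : ℝ) ≠ 0 := by
    intro hm
    have hm0 : m = 0 := by exact_mod_cast hm
    obtain ⟨w, hw⟩ := hfξ x hx
    have hw0 : w = 0 := by
      ext i
      exact absurd i.2 (by omega)
    rw [hw0, map_zero] at hw
    exact hS.xi_ne_zero hfx hw.symm
  have hab : (c - 1) / 2 + m * (c + 3) / 2 + -(m + 1) * (c - 1) / 2 ≠ 0 := by
    have : (c - 1) / 2 + m * (c + 3) / 2 + -(m + 1) * (c - 1) / 2 = 2 * (m : ℝ) := by ring
    rw [this]
    exact mul_ne_zero two_ne_zero hm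
  have hM := hS.isMetricOn_pullbackForm_deform ha hab hGh hO hf hU hinj hfξ
  have hbi' : localBitension (ricci G) f s x = 0 := by
    have h1 := congrArg (coords (ψ p) (ψ p)) (hbi p)
    rw [ricciBitension, coords_ofCoords hψpp, map_zero] at h1
    exact h1
  obtain ⟨w, hw, hw0⟩ := hS.fderiv_normSq_eq_zero ha hab hGh hM hf hU hs hsn hsξ hx rfl
    (hinj x hx) hsx hbi'
  obtain ⟨w, rfl⟩ := (isInvertible_coords hpp).surjective w
  refine ⟨w, ?_, ?_⟩
  · apply (isInvertible_coords hψpp).injective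
    rw [hψ.fderiv_localMap hpp hψpp] at hw
    rw [hw, hfdef, hxdef, localMap_extChartAt hpp, hsdef, localAlong_extChartAt hpp,
      localEndo_coords hψpp]
  -- The chart computation concerns |H|². Its differential is 2|H| d|H|, and |H| ≠ 0 at p.
  · have hsq : (fun z ↦ G (f z) (s z) (s z)) =ᶠ[𝓝 x] fun z ↦
        ((meanCurvature (k := 2 * m) S.metric ψ) ∘ (extChartAt (𝓡 (2 * m)) p).symm) z ^ 2 := by
      filter_upwards [hO.mem_nhds hx] with z hz
      obtain ⟨q, hq, hψq, rfl⟩ := exists_of_mem_localDomain hz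
      rw [hfdef, hsdef, localMap_extChartAt hq, localAlong_extChartAt hq, localMetric_coords hψq,
        Function.comp_apply, (extChartAt (𝓡 (2 * m)) p).left_inv hq, meanCurvature, Real.sq_sqrt]
      by_cases h0 : meanCurvatureVector (k := 2 * m) S.metric ψ q = 0
      · rw [h0, map_zero]
      · exact (S.metric.pos _ _ h0).le
    have hd := differentiableAt_comp_extChartAt_symm hpp (hdiff p)
    rw [hsq.fderiv_eq, (hd.hasFDerivAt.pow 2).fderiv, smul_apply,
      fderiv_comp_extChartAt_symm hpp (hdiff p)] at hw0
    refine (smul_eq_zero.1 hw0).resolve_left ?_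
    rw [Function.comp_apply, (extChartAt (𝓡 (2 * m)) p).left_inv hpp]
    have h1 : meanCurvature (k := 2 * m) S.metric ψ p ≠ 0 :=
      (Real.sqrt_pos.2 (S.metric.pos _ _ hp)).ne'
    simpa using h1

end Hypersurface

end RicciBiharmonic

/-! ### The main theorem. -/

theorem mainTheorem6 {m : ℕ}
    {P : Type*} [TopologicalSpace P] [ChartedSpace (EuclideanSpace ℝ (Fin (2 * m + 1))) P]
    [IsManifold (𝓡 (2 * m + 1)) ∞ P]
    {M : Type*} [TopologicalSpace M] [ChartedSpace (EuclideanSpace ℝ (Fin (2 * m))) M]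
    [IsManifold (𝓡 (2 * m)) ∞ M] [PreconnectedSpace M]
    (S : SasakianStructure (2 * m + 1) P) (c : ℝ) (hc : S.IsSpaceForm c)
    (hRic : RicciIsMetric S.metric)
    (ψ : M → P) (hψ : IsSmoothImmersion (k := 2 * m) (n := 2 * m + 1) ψ)
    (hξ : XiTangent (k := 2 * m) ψ S)
    (N : ∀ p : M, TangentSpace (𝓡 (2 * m + 1)) (ψ p))
    (hN : IsUnitNormal (k := 2 * m) S.metric ψ N)
    (hHopf : IsPseudoHopf (k := 2 * m) S ψ N)
    (hbi : IsRicciBiharmonic (k := 2 * m) S.metric ψ)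
    (β : M → ℝ)
    (hdiff : MDifferentiable (𝓡 (2 * m)) 𝓘(ℝ, ℝ) (meanCurvature (k := 2 * m) S.metric ψ))
    (hgrad : ∀ p : M, mfderiv (𝓡 (2 * m)) (𝓡 (2 * m + 1)) ψ p
      (surfaceGradient (k := 2 * m) S.metric ψ (meanCurvature (k := 2 * m) S.metric ψ) p) =
        β p • fieldV S ψ N p) :
    (∀ p : M, β p = 0) ∧
      ∃ a : ℝ, ∀ p : M, meanCurvature (k := 2 * m) S.metric ψ p = a := by
  have hξN : ∀ p, S.metric.inner (ψ p) (S.xi (ψ p)) (N p) = 0 := by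
    intro p
    obtain ⟨u, hu⟩ := hξ p
    rw [← hu, S.metric.symm, (hN p).2 u]
  have hdh : ∀ (p : M) (w : TangentSpace (𝓡 (2 * m)) p),
      mfderiv (𝓡 (2 * m)) 𝓘(ℝ, ℝ) (meanCurvature (k := 2 * m) S.metric ψ) p w =
        β p * S.metric.inner (ψ p) (fieldV S ψ N p)
          (mfderiv (𝓡 (2 * m)) (𝓡 (2 * m + 1)) ψ p w) := by
    intro p w
    have h1 : inducedMetric (k := 2 * m) S.metric ψ p
        (surfaceGradient (k := 2 * m) S.metric ψ (meanCurvature (k := 2 * m) S.metric ψ) p) w =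
        mfderiv (𝓡 (2 * m)) 𝓘(ℝ, ℝ) (meanCurvature (k := 2 * m) S.metric ψ) p w := by
      exact congrArg (fun L ↦ L w)
        ((hψ.isInvertible_inducedMetric S.metric p).self_apply_inverse _)
    rw [← h1, inducedMetric, pullForm_apply, hgrad p, map_smul]
    rfl
  have hβ : ∀ p : M, β p = 0 := by
    intro p
    by_cases hH : meanCurvatureVector (k := 2 * m) S.metric ψ p = 0
    · have hmin : ∀ q, meanCurvature (k := 2 * m) S.metric ψ p ≤
          meanCurvature (k := 2 * m) S.metric ψ q := by
        intro q
        have h0 : meanCurvature (k := 2 * m) S.metric ψ p = 0 := by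
          rw [meanCurvature, hH, map_zero, Real.sqrt_zero]
        rw [h0]
        exact Real.sqrt_nonneg _
      -- At a zero of H the function |H| attains its minimum. Evaluating its vanishing differential
      -- on the gradient βV gives β²|V|² = β² = 0.
      have h1 := hdh p (surfaceGradient (k := 2 * m) S.metric ψ
        (meanCurvature (k := 2 * m) S.metric ψ) p)
      rw [mfderiv_eq_zero_of_isMin (hdiff p) hmin, hgrad p, map_smul] at h1
      have h2 : S.metric.inner (ψ p) (fieldV S ψ N p) (fieldV S ψ N p) = 1 := by
        rw [fieldV, map_neg, map_neg, neg_apply, neg_neg, S.metric_phi, (hN p).1, hξN p]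
        ring
      rw [h2] at h1
      have h3 : 0 = β p * (β p * 1) := h1
      simpa using h3.symm
    · obtain ⟨w, hw, hw0⟩ := exists_mfderiv_meanCurvature_eq_zero hc hRic hψ hξ hbi hdiff p hH
      rw [hdh, hw, fieldV, map_neg, neg_apply, S.metric_phi, hξN p, zero_mul, sub_zero] at hw0
      -- The factor of β is −g(N,H). If it vanished, N would be orthogonal to the nonzero normal
      -- vector H, hence tangent because the codimension is one, and so orthogonal to itself.
      refine (mul_eq_zero.1 hw0).resolve_right (neg_ne_zero.2 fun h0 ↦ ?_)
      have hl : (S.metric.inner (ψ p) (meanCurvatureVector (k := 2 * m) S.metric ψ p)).toLinearMap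
          ≠ 0 := fun h ↦ (S.metric.pos _ _ hH).ne' (LinearMap.congr_fun h _)
      obtain ⟨u, hu⟩ := exists_eq_of_orthogonal
        (by
          have h1 : Module.finrank ℝ (TangentSpace (𝓡 (2 * m)) p) = 2 * m :=
            finrank_euclideanSpace_fin
          have h2 : Module.finrank ℝ (TangentSpace (𝓡 (2 * m + 1)) (ψ p)) = 2 * m + 1 :=
            finrank_euclideanSpace_fin
          rw [h1, h2])
        _ hl (mfderiv (𝓡 (2 * m)) (𝓡 (2 * m + 1)) ψ p).toLinearMap (hψ.2 p)
        (hψ.inner_meanCurvatureVector S.metric p) (w := N p)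
        (by rw [← h0]; exact S.metric.symm _ _ _)
      have h1 := (hN p).2 u
      have h2 : mfderiv (𝓡 (2 * m)) (𝓡 (2 * m + 1)) ψ p u = N p := hu
      rw [h2, (hN p).1] at h1
      exact one_ne_zero h1
  have hz : ∀ (p : M) (u : TangentSpace (𝓡 (2 * m)) p),
      mfderiv (𝓡 (2 * m)) 𝓘(ℝ, ℝ) (meanCurvature (k := 2 * m) S.metric ψ) p u = 0 := by
    intro p u
    rw [hdh, hβ p, zero_mul]
    rfl
  obtain ⟨a, ha⟩ := (isLocallyConstant_of_mfderiv_eq_zero hdiff hz).exists_eq_const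
  exact ⟨hβ, a, fun p ↦ congrFun ha p⟩
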